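/- We test functions $f:\{0,1\}^n\to\{0,1\}$ for unateness (for each coordinate $i$, $f$ is non-decreasing in $x_i$ or non-increasing in $x_i$). For $f\not\equiv 0$ put $$\mathsf{reldist}(f,\mathrm{unate})=\min_{g\ \mathrm{unate}}\frac{|f^{-1}(1)\,\triangle\,g^{-1}(1)|}{|f^{-1}(1)|}.$$ A non-adaptive relative-error algorithm is randomized; it first draws independent uniform samples from $f^{-1}(1)$, then makes one parallel round of black-box queries to $f$ (the query points may depend on the samples and on the internal randomness, but not on answers to other queries), and then answers "yes" or "no". Its query complexity is the worst-case total number of samples and black-box queries. **Theorem.** For every constant $\alpha_0<1$ there are constants $\varepsilon_0>0$, $C\ge 1$, $c>0$ and $k,N_0\in\mathbb N$, depending only on $\alpha_0$, such that the following holds for all $n$ and all integers $N\ge N_0$ with $N\le 2^{\alpha_0 n}$. Let $T$ be any non-adaptive relative-error algorithm (with two-sided error; it may depend on $n$ and $N$) such that, for every $f:\{0,1\}^n\to\{0,1\}$ with $f\not\equiv0$ and $N/C\le |f^{-1}(1)|\le C N$, it answers "yes" with probability at least $2/3$ if $f$ is unate, and answers "no" with probability at least $2/3$ if $\mathsf{reldist}(f,\mathrm{unate})\ge\varepsilon_0$.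 If $T$ always makes at most $q$ samples and queries in total, then $$q\ \ge\ c\,\frac{\log N}{(\log\log N)^{k}}.$$ In other words, $\tilde\Omega(\log N)$ samples and queries are necessary, even if $|f^{-1}(1)|$ is known up to a constant factor. -/

import Mathlib

namespace RelativeError

/-- The Boolean hypercube `{0,1}^n`. -/
abbrev Cube (n : ℕ) : Type := Fin n → Bool

/-- The satisfying assignments `f⁻¹(1)`. -/
def satSet {n : ℕ} (f : Cube n → Bool) : Finset (Cube n) :=
  Finset.univ.filter fun x => f x = true

/-- `f` is `1`-monotone in direction `i`. -/
def OneMonotoneIn {n : ℕ} (f : Cube n → Bool) (i : Fin n) : Prop :=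
  ∀ x : Cube n, f (Function.update x i false) ≤ f (Function.update x i true)

/-- `f` is `0`-monotone in direction `i`. -/
def ZeroMonotoneIn {n : ℕ} (f : Cube n → Bool) (i : Fin n) : Prop :=
  ∀ x : Cube n, f (Function.update x i true) ≤ f (Function.update x i false)

/-- The class of unate functions on `{0,1}^n`. -/
def unate (n : ℕ) : Set (Cube n → Bool) :=
  {f | ∀ i : Fin n, OneMonotoneIn f i ∨ ZeroMonotoneIn f i}

/-- `reldist(f, g) = |f⁻¹(1) ∆ g⁻¹(1)| / |f⁻¹(1)|`
(only meaningful, and only used, for `f` not identically `0`). -/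
noncomputable def relDist {n : ℕ} (f g : Cube n → Bool) : ℝ :=
  ((symmDiff (satSet f) (satSet g)).card : ℝ) / ((satSet f).card : ℝ)

/-- `reldist(f, 𝒞) = min_{g ∈ 𝒞} reldist(f, g)`; for a nonempty class the infimum is over a
finite nonempty set of reals, hence a minimum. -/
noncomputable def relDistTo {n : ℕ} (f : Cube n → Bool) (𝒞 : Set (Cube n → Bool)) : ℝ :=
  sInf (relDist f '' 𝒞)

/-- A deterministic non-adaptive relative-error testing algorithm on `{0,1}^n`. It first calls the
sampling oracle some number of times (`sample next` asks for one sample `x` and goes on with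
`next x`, so that the decision to stop sampling may depend on the samples received). Then it
makes a single parallel round of black-box queries (`query pts accept` asks for the values of `f`
at all points of the list `pts` at once), and answers `accept b` (`true` is "yes", `false` is
"no"), where `b` is the list of values received. The points and the final decision may depend on
the samples, but no query point depends on the answer to another query. -/
inductive NonadaptiveAlg (n : ℕ) : Type
  | sample (next : Cube n → NonadaptiveAlg n) : NonadaptiveAlg n
  | query (pts : List (Cube n)) (accept : List Bool → Bool) : NonadaptiveAlg n

namespace NonadaptiveAlg

/-- `A.MakesAtMost q`: the total number of samples and queries that `A` makes is at most `q`,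
whatever the oracles return. -/
def MakesAtMost {n : ℕ} : NonadaptiveAlg n → ℕ → Prop
  | query pts _, q => pts.length ≤ q
  | sample _, 0 => False
  | sample next, q + 1 => ∀ x : Cube n, (next x).MakesAtMost q

/-- The distribution of the answer of `A` on input `f`: each call of the sampling oracle returns
a fresh independent uniform element of `f⁻¹(1)`. -/
noncomputable def output {n : ℕ} (f : Cube n → Bool) (hf : (satSet f).Nonempty) :
    NonadaptiveAlg n → PMF Bool
  | sample next => (PMF.uniformOfFinset (satSet f) hf).bind fun x => output f hf (next x)
  | query pts accept => PMF.pure (accept (pts.map f))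

end NonadaptiveAlg

/-- A randomized non-adaptive algorithm: its internal randomness selects a deterministic one. -/
abbrev RandomizedAlg (n : ℕ) : Type := PMF (NonadaptiveAlg n)

/-- On every outcome of its internal randomness, `T` makes at most `q` samples and queries. -/
def RandomizedAlg.MakesAtMost {n : ℕ} (T : RandomizedAlg n) (q : ℕ) : Prop :=
  ∀ A ∈ T.support, A.MakesAtMost q

/-- The distribution of the answer of `T` on input `f`, over the internal randomness and the
samples. -/
noncomputable def RandomizedAlg.output {n : ℕ} (T : RandomizedAlg n) (f : Cube n → Bool)
    (hf : (satSet f).Nonempty) : PMF Bool :=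
  T.bind fun A => A.output f hf

/-- `T` is a (two-sided error) `ε`-relative-error tester for the class `𝒞` under the promise that
the unknown function lies in `𝓓`: it says "yes" with probability at least `2/3` on functions in
`𝒞`, and "no" with probability at least `2/3` on functions at relative distance at least `ε`
from `𝒞`. -/
def IsTesterUnderPromise {n : ℕ} (T : RandomizedAlg n) (ε : ℝ)
    (𝒞 𝓓 : Set (Cube n → Bool)) : Prop :=
  ∀ (f : Cube n → Bool) (hf : (satSet f).Nonempty), f ∈ 𝓓 →
    (f ∈ 𝒞 → 2 / 3 ≤ T.output f hf true) ∧
    (ε ≤ relDistTo f 𝒞 → 2 / 3 ≤ T.output f hf false)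

/-- The functions on `{0,1}^n` with `N / C ≤ |f⁻¹(1)| ≤ C * N`. -/
def sizeWithinFactor (n : ℕ) (C : ℝ) (N : ℕ) : Set (Cube n → Bool) :=
  {f | (N : ℝ) / C ≤ ((satSet f).card : ℝ) ∧ ((satSet f).card : ℝ) ≤ C * (N : ℝ)}

end RelativeError

/-! By averaging, it suffices to find a random unate function and a random function that is often
far from unate, such that every deterministic algorithm with few samples and queries accepts both
with almost the same probability. Both are Talagrand-style functions on `m = 6t` main coordinates:
they vanish above level `k = 2t` and carry about `1/p` random terms `T j` of `t` variables, `p`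
being the probability that a random term lies in a given `2t`-set. On the top two levels, a point
that satisfies exactly one term `j` shows a payload: a random bit `β j` in the unate family, a
literal of random sign in a random variable `v j` in the other.

Two flags adapt this to relative error. When exactly one is set, exchanging them complements the
payload, so `|f⁻¹(1)|` does not depend on the payload and the samples of both families have the same
normalization (`card_satSet_truncatedTalagrand_eq`). When neither is set, the function is `1`
exactly up to level `k`, so a unate `g` that is non-decreasing in some main coordinate is already
far from it. Any other unate `g` is non-increasing in all main coordinates and errs on a constant
fraction of the edges `X, X ∪ {v j}` along which only term `j` is satisfied, since one of the two
flag patterns makes the function increase there (`le_relDistTo_unate`). Free coordinates bring the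
size to about `N`.

The algorithm can tell the families apart only by seeing two points of one term `j` that differ in
`v j`; otherwise flipping some of the `β j` turns one family into the other (`exists_relabeling`,
`totalPayoff_accept_le`). As `v j` is uniform, the expected number of coordinates on which the seen
points of term `j` disagree, divided by `m`, bounds this event. The samples depend on `T j`, but
erasing term `j` enlarges `f⁻¹(1)` only by a factor `1 + 4p`, which costs a constant over `q`
samples; then `T j` is independent of the run (`sum_expectedPayoff_disagreement_le`). For fixed
points, two that are far apart rarely share a random term and close ones differ in few coordinates,
so the expectation is at most `p q (2r + 1)` with `2 ^ r ≥ m²`. Summing over the terms, a tester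
needs `q (2r + 1) = Ω(t)`, where `t = Θ(log N)` and `r = O(log log N)`. -/

namespace RelativeError

open Finset
open scoped ENNReal

/-! ### Expected payoffs of algorithms and the averaging argument -/

/-- A quantity read off at the end of the sampling phase of a non-adaptive algorithm, from the
samples (latest first), the query points and the acceptance rule. -/
abbrev Payoff (n : ℕ) : Type :=
  List (Cube n) → List (Cube n) → (List Bool → Bool) → ℝ

/-- The expectation of `G` when `A` runs on `f`, with the samples `h` already received. -/
noncomputable def expectedPayoff {n : ℕ} (f : Cube n → Bool) (G : Payoff n) :
    NonadaptiveAlg n → List (Cube n) → ℝ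
  | .query pts a, h => G h pts a
  | .sample next, h =>
      (∑ x ∈ satSet f, expectedPayoff f G (next x) (x :: h)) / ((satSet f).card : ℝ)

section expectedPayoff

variable {n : ℕ} {f g : Cube n → Bool} {G G' : Payoff n}

theorem expectedPayoff_nonneg (hG : ∀ h pts a, 0 ≤ G h pts a) (A : NonadaptiveAlg n)
    (h : List (Cube n)) : 0 ≤ expectedPayoff f G A h := by
  induction A generalizing h with
  | query pts a => exact hG _ _ _
  | sample next ih =>
    exact div_nonneg (sum_nonneg fun x _ => ih x _) (Nat.cast_nonneg _)

theorem expectedPayoff_mono (hG : ∀ h pts a, G h pts a ≤ G' h pts a) (A : NonadaptiveAlg n)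
    (h : List (Cube n)) : expectedPayoff f G A h ≤ expectedPayoff f G' A h := by
  induction A generalizing h with
  | query pts a => exact hG _ _ _
  | sample next ih =>
    exact div_le_div_of_nonneg_right (sum_le_sum fun x _ => ih x _) (Nat.cast_nonneg _)

theorem expectedPayoff_sum {ι : Type*} (s : Finset ι) (G : ι → Payoff n) (A : NonadaptiveAlg n)
    (h : List (Cube n)) :
    expectedPayoff f (fun h pts a => ∑ i ∈ s, G i h pts a) A h
      = ∑ i ∈ s, expectedPayoff f (G i) A h := by
  induction A generalizing h with
  | query pts a => rfl
  | sample next ih =>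
    simp only [expectedPayoff, ih]
    rw [sum_comm, sum_div]

theorem expectedPayoff_mul (c : ℝ) (A : NonadaptiveAlg n) (h : List (Cube n)) :
    expectedPayoff f (fun h pts a => c * G h pts a) A h = c * expectedPayoff f G A h := by
  induction A generalizing h with
  | query pts a => rfl
  | sample next ih =>
    simp only [expectedPayoff, ih]
    rw [← mul_sum, mul_div_assoc]

theorem makesAtMost_sample_iff {next : Cube n → NonadaptiveAlg n} {q : ℕ} :
    (NonadaptiveAlg.sample next).MakesAtMost q ↔
      ∃ q', q = q' + 1 ∧ ∀ x, (next x).MakesAtMost q' := by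
  cases q with
  | zero => simp [NonadaptiveAlg.MakesAtMost]
  | succ q => simp [NonadaptiveAlg.MakesAtMost]

theorem expectedPayoff_le_of_le (hf : (satSet f).Nonempty) {c : ℝ} {Q : ℕ}
    (hG : ∀ h pts a, h.length + pts.length ≤ Q → G h pts a ≤ c) (A : NonadaptiveAlg n) (q : ℕ)
    (hA : A.MakesAtMost q) (h : List (Cube n)) (hQ : h.length + q ≤ Q) :
    expectedPayoff f G A h ≤ c := by
  induction A generalizing h q with
  | query pts a =>
    refine hG _ _ _ (le_trans ?_ hQ)
    simpa [NonadaptiveAlg.MakesAtMost] using hA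
  | sample next ih =>
    obtain ⟨q, rfl, hA⟩ := makesAtMost_sample_iff.1 hA
    have hc : (0 : ℝ) < (satSet f).card := by exact_mod_cast hf.card_pos
    rw [expectedPayoff, div_le_iff₀ hc, mul_comm, ← nsmul_eq_mul]
    refine sum_le_card_nsmul _ _ _ fun x _ => ih x q (hA x) _ ?_
    simp only [List.length_cons]
    omega

/-- Enlarging the set of satisfying assignments by a factor at most `ρ` lowers the expectation of
a nonnegative payoff by at most a factor `ρ` per sample. -/
theorem expectedPayoff_le_pow_mul (hf : (satSet f).Nonempty) (hfg : satSet f ⊆ satSet g) {ρ : ℝ}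
    (hρ : 1 ≤ ρ) (hcard : ((satSet g).card : ℝ) ≤ ρ * (satSet f).card)
    (hG : ∀ h pts a, 0 ≤ G h pts a) (A : NonadaptiveAlg n) (q : ℕ)
    (hA : A.MakesAtMost q) (h : List (Cube n)) :
    expectedPayoff f G A h ≤ ρ ^ q * expectedPayoff g G A h := by
  induction A generalizing h q with
  | query pts a =>
    exact le_mul_of_one_le_left (hG _ _ _) (one_le_pow₀ hρ)
  | sample next ih =>
    obtain ⟨q, rfl, hA⟩ := makesAtMost_sample_iff.1 hA
    have hc : (0 : ℝ) < (satSet f).card := by exact_mod_cast hf.card_pos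
    have hc' : (0 : ℝ) < (satSet g).card := by exact_mod_cast (hf.mono hfg).card_pos
    have h1 : ∑ x ∈ satSet f, expectedPayoff f G (next x) (x :: h)
        ≤ ρ ^ q * ∑ x ∈ satSet g, expectedPayoff g G (next x) (x :: h) := by
      rw [mul_sum]
      refine (sum_le_sum fun x _ => ih x q (hA x) (x :: h)).trans ?_
      exact sum_le_sum_of_subset_of_nonneg hfg fun x _ _ =>
        mul_nonneg (by positivity) (expectedPayoff_nonneg hG _ _)
    rw [expectedPayoff, expectedPayoff, div_le_iff₀ hc]
    refine h1.trans ?_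
    have hS : 0 ≤ ∑ x ∈ satSet g, expectedPayoff g G (next x) (x :: h) :=
      sum_nonneg fun x _ => expectedPayoff_nonneg hG _ _
    calc _ = ρ ^ q * ((∑ x ∈ satSet g, expectedPayoff g G (next x) (x :: h))
              / (satSet g).card) * (satSet g).card := by field_simp
      _ ≤ ρ ^ q * ((∑ x ∈ satSet g, expectedPayoff g G (next x) (x :: h))
              / (satSet g).card) * (ρ * (satSet f).card) := by gcongr
      _ = _ := by ring

/-- The payoff `1` for the answer "yes", `0` for the answer "no". -/
noncomputable def acceptPayoff (f : Cube n → Bool) : Payoff n :=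
  fun _ pts a => if a (pts.map f) then 1 else 0

theorem acceptPayoff_nonneg (f : Cube n → Bool) (h pts a) : 0 ≤ acceptPayoff f h pts a := by
  unfold acceptPayoff; split_ifs <;> norm_num

/-- The probability that `A` says "yes" on `f`. -/
noncomputable def acceptProb (f : Cube n → Bool) (A : NonadaptiveAlg n) : ℝ :=
  expectedPayoff f (acceptPayoff f) A []

theorem acceptProb_nonneg (f : Cube n → Bool) (A : NonadaptiveAlg n) : 0 ≤ acceptProb f A :=
  expectedPayoff_nonneg (acceptPayoff_nonneg f) _ _

theorem output_true_eq (hf : (satSet f).Nonempty) (A : NonadaptiveAlg n) (h : List (Cube n)) :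
    A.output f hf true = ENNReal.ofReal (expectedPayoff f (acceptPayoff f) A h) := by
  induction A generalizing h with
  | query pts a =>
    simp only [NonadaptiveAlg.output, PMF.pure_apply, expectedPayoff, acceptPayoff]
    cases a (pts.map f) <;> simp
  | sample next ih =>
    have hc : (0 : ℝ) < (satSet f).card := by exact_mod_cast hf.card_pos
    rw [NonadaptiveAlg.output, PMF.bind_apply, tsum_fintype, expectedPayoff,
      ENNReal.ofReal_div_of_pos hc, ENNReal.ofReal_sum_of_nonneg
        (fun x _ => expectedPayoff_nonneg (acceptPayoff_nonneg f) _ _),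
      ENNReal.ofReal_natCast, div_eq_mul_inv, sum_mul]
    rw [← sum_subset (subset_univ (satSet f))]
    · refine sum_congr rfl fun x hx => ?_
      rw [PMF.uniformOfFinset_apply_of_mem hf hx, ih x (x :: h), mul_comm]
    · intro x _ hx
      rw [PMF.uniformOfFinset_apply_of_notMem hf hx, zero_mul]

theorem randomized_output_true_eq (hf : (satSet f).Nonempty) (T : RandomizedAlg n) :
    T.output f hf true = ∑' A, T A * ENNReal.ofReal (acceptProb f A) := by
  rw [RandomizedAlg.output, PMF.bind_apply]
  exact tsum_congr fun A => by rw [output_true_eq hf A []]; rfl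

theorem pmf_true_le_of_le_false (P : PMF Bool) (h : 2 / 3 ≤ P false) : P true ≤ 1 / 3 := by
  have h1 : P true + P false = 1 := by
    have := P.tsum_coe
    rwa [tsum_fintype, Fintype.sum_bool] at this
  have h2 : P true + 2 / 3 ≤ 1 / 3 + 2 / 3 := by
    calc P true + 2 / 3 ≤ P true + P false := by gcongr
      _ = 1 := h1
      _ = 1 / 3 + 2 / 3 := by
        rw [← ENNReal.add_div]
        norm_num
        exact (ENNReal.div_self (by norm_num) (by norm_num)).symm
  exact (ENNReal.add_le_add_iff_right (ENNReal.div_ne_top (by norm_num) (by norm_num))).1 h2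

/-- If the families `Y` and `Z` are accepted with average probabilities that differ by at most `δ`
by every algorithm in the support of `T`, then `T` cannot accept all of `Y` and reject all
of `Z`. -/
theorem card_le_of_acceptProb_le {I : Type*} (s : Finset I) (Y Z : I → Cube n → Bool)
    (hY : ∀ i, (satSet (Y i)).Nonempty) (hZ : ∀ i, (satSet (Z i)).Nonempty) (T : RandomizedAlg n)
    (hTY : ∀ i ∈ s, 2 / 3 ≤ T.output (Y i) (hY i) true)
    (hTZ : ∀ i ∈ s, 2 / 3 ≤ T.output (Z i) (hZ i) false) {δ : ℝ} (hδ : 0 ≤ δ)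
    (hA : ∀ A ∈ T.support, ∑ i ∈ s, acceptProb (Y i) A ≤ ∑ i ∈ s, acceptProb (Z i) A + δ) :
    (s.card : ℝ) / 3 ≤ δ := by
  have h1 : (s.card : ℝ≥0∞) * (2 / 3) ≤ ∑ i ∈ s, T.output (Y i) (hY i) true := by
    rw [← nsmul_eq_mul]
    exact card_nsmul_le_sum _ _ _ hTY
  have h2 : ∑ i ∈ s, T.output (Z i) (hZ i) true ≤ s.card * (1 / 3) := by
    rw [← nsmul_eq_mul]
    exact sum_le_card_nsmul _ _ _ fun i hi => pmf_true_le_of_le_false _ (hTZ i hi)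
  have key : ∀ W : I → Cube n → Bool, ∀ hW : ∀ i, (satSet (W i)).Nonempty,
      ∑ i ∈ s, T.output (W i) (hW i) true
        = ∑' A, T A * ENNReal.ofReal (∑ i ∈ s, acceptProb (W i) A) := by
    intro W hW
    simp_rw [randomized_output_true_eq]
    rw [← Summable.tsum_finsetSum fun _ _ => ENNReal.summable]
    refine tsum_congr fun A => ?_
    rw [ENNReal.ofReal_sum_of_nonneg fun i _ => acceptProb_nonneg _ _, mul_sum]
  have h3 : ∑ i ∈ s, T.output (Y i) (hY i) true
      ≤ ∑ i ∈ s, T.output (Z i) (hZ i) true + ENNReal.ofReal δ := by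
    rw [key Y hY, key Z hZ]
    calc _ ≤ ∑' A, (T A * ENNReal.ofReal (∑ i ∈ s, acceptProb (Z i) A)
            + T A * ENNReal.ofReal δ) := by
          refine ENNReal.tsum_le_tsum fun A => ?_
          by_cases hAT : A ∈ T.support
          · rw [← mul_add, ← ENNReal.ofReal_add
              (sum_nonneg fun i _ => acceptProb_nonneg _ _) hδ]
            gcongr
            exact hA A hAT
          · rw [PMF.apply_eq_zero_iff T A |>.2 hAT]
            simp
      _ = _ := by
          rw [ENNReal.tsum_add, ENNReal.tsum_mul_right, T.tsum_coe, one_mul]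
  have h4 : ENNReal.ofReal (s.card * (2 / 3)) ≤ ENNReal.ofReal (s.card * (1 / 3) + δ) := by
    have e : ∀ a : ℝ, 0 ≤ a →
        ENNReal.ofReal (s.card * (a / 3)) = s.card * (ENNReal.ofReal a / 3) := by
      intro a ha
      rw [ENNReal.ofReal_mul (Nat.cast_nonneg _), ENNReal.ofReal_natCast,
        ENNReal.ofReal_div_of_pos (by norm_num)]
      norm_num
    rw [ENNReal.ofReal_add (by positivity) hδ, e 2 (by norm_num), e 1 (by norm_num)]
    norm_num
    calc _ ≤ _ := h1
      _ ≤ _ := h3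
      _ ≤ _ := by gcongr; simpa using h2
  have h5 := (ENNReal.ofReal_le_ofReal_iff (by positivity)).1 h4
  linarith

end expectedPayoff

/-! ### Layout of the coordinates -/

/-- A division of the `n` coordinates into `m` main ones, two flags, `b` free ones, and the others,
which have to be `false`. -/
structure Layout (n : ℕ) where
  m : ℕ
  b : ℕ
  le : m + 2 + b ≤ n

namespace Layout

variable {n : ℕ} (L : Layout n)

/-- The position of the main coordinate `i`. -/
def main (i : Fin L.m) : Fin n := ⟨i, by have := L.le; omega⟩

/-- The positions of the two flags. -/
def flagPos (s : Bool) : Fin n := ⟨L.m + s.toNat, by have := L.le; cases s <;> simp <;> omega⟩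

/-- The set of main coordinates equal to `true`. -/
def ones (u : Cube n) : Finset (Fin L.m) := univ.filter fun i => u (L.main i) = true

/-- All coordinates outside of the main ones, the flags and the free ones are `false`. -/
def Alive (u : Cube n) : Prop := ∀ i : Fin n, L.m + 2 + L.b ≤ i → u i = false

/-- The point with given main, flag and free parts, and `false` elsewhere. -/
def point (X : Finset (Fin L.m)) (c : Bool → Bool) (y : Fin L.b → Bool) : Cube n := fun i =>
  if h : (i : ℕ) < L.m then decide (⟨i, h⟩ ∈ X)
  else if (i : ℕ) = L.m then c false
  else if (i : ℕ) = L.m + 1 then c true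
  else if h : (i : ℕ) - (L.m + 2) < L.b then y ⟨i - (L.m + 2), h⟩
  else false

variable {L}

@[simp] theorem mem_ones {u : Cube n} {i : Fin L.m} : i ∈ L.ones u ↔ u (L.main i) = true := by
  simp [ones]

theorem main_injective : Function.Injective L.main := fun i j h => by
  ext; simpa [main] using congrArg Fin.val h

theorem main_ne_flagPos (i : Fin L.m) (s : Bool) : L.main i ≠ L.flagPos s := fun h => by
  have h := congrArg Fin.val h
  have := i.2
  simp only [main, flagPos] at h
  omega

@[simp] theorem ones_point (X c y) : L.ones (L.point X c y) = X := by
  ext i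
  simp only [mem_ones, point, main, Fin.is_lt, ↓reduceDIte, Fin.eta]
  exact decide_eq_true_iff

@[simp] theorem point_flagPos (X c y) (s : Bool) : L.point X c y (L.flagPos s) = c s := by
  cases s <;> simp [point, flagPos]

theorem alive_point (X c y) : L.Alive (L.point X c y) := by
  intro i hi
  have h1 : ¬ (i : ℕ) < L.m := by omega
  have h2 : (i : ℕ) ≠ L.m := by omega
  have h3 : (i : ℕ) ≠ L.m + 1 := by omega
  have h4 : ¬ (i : ℕ) - (L.m + 2) < L.b := by omega
  simp [point, h1, h2, h3, h4]

theorem eq_point {u : Cube n} (hu : L.Alive u) :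
    u = L.point (L.ones u) (fun s => u (L.flagPos s))
      (fun i => u ⟨i + (L.m + 2), by have := L.le; have := i.2; omega⟩) := by
  ext i
  simp only [point]
  split_ifs with h1 h2 h3 h4
  · simp [main]
  · congr 1; ext; simp [flagPos, h2]
  · congr 1; ext; simp [flagPos, h3]
  · congr 1; ext; simp; omega
  · exact hu i (by omega)

theorem point_injective (c : Bool → Bool) :
    Function.Injective fun p : Finset (Fin L.m) × (Fin L.b → Bool) => L.point p.1 c p.2 := by
  rintro ⟨X, y⟩ ⟨X', y'⟩ h
  have hX : X = X' := by simpa using congrArg L.ones h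
  refine Prod.ext hX (funext fun i => ?_)
  have := congrFun h ⟨i + (L.m + 2), by have := L.le; have := i.2; omega⟩
  have h1 : ¬ ((i : ℕ) + (L.m + 2) < L.m) := by omega
  have h2 : ¬ ((i : ℕ) + (L.m + 2) = L.m) := by omega
  have h3 : ¬ ((i : ℕ) + (L.m + 2) = L.m + 1) := by omega
  simpa [point, h1, h2, h3] using this

theorem card_filter_alive (c : Bool → Bool) (P : Finset (Fin L.m) → Prop) [DecidablePred P]
    [DecidablePred fun u : Cube n =>
      L.Alive u ∧ (∀ s, u (L.flagPos s) = c s) ∧ P (L.ones u)] :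
    #{u : Cube n | L.Alive u ∧ (∀ s, u (L.flagPos s) = c s) ∧ P (L.ones u)}
      = #{X : Finset (Fin L.m) | P X} * 2 ^ L.b := by
  have h : ({u : Cube n | L.Alive u ∧ (∀ s, u (L.flagPos s) = c s) ∧ P (L.ones u)} : Finset _)
      = (({X : Finset (Fin L.m) | P X} : Finset _) ×ˢ (univ : Finset (Fin L.b → Bool))).map
          ⟨_, point_injective c⟩ := by
    ext u
    simp only [mem_filter, mem_univ, true_and, mem_map, mem_product, and_true,
      Function.Embedding.coeFn_mk, Prod.exists]
    constructor
    · rintro ⟨h1, h2, h3⟩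
      refine ⟨L.ones u, fun i => u ⟨i + (L.m + 2), by have := L.le; have := i.2; omega⟩, h3, ?_⟩
      conv_rhs => rw [eq_point h1]
      rw [show (fun s => u (L.flagPos s)) = c from funext h2]
    · rintro ⟨X, y, hX, rfl⟩
      exact ⟨alive_point _ _ _, fun s => point_flagPos _ _ _ _, by simpa using hX⟩
  rw [h, card_map, card_product]
  simp

theorem ones_update_main (u : Cube n) (i : Fin L.m) (v : Bool) :
    L.ones (Function.update u (L.main i) v)
      = if v then insert i (L.ones u) else (L.ones u).erase i := by
  ext j
  by_cases hj : j = i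
  · subst hj; cases v <;> simp
  · have : L.main j ≠ L.main i := fun h => hj (main_injective h)
    cases v <;> simp [hj, Function.update_of_ne this]

theorem alive_update_main {u : Cube n} (i : Fin L.m) (v : Bool) :
    L.Alive (Function.update u (L.main i) v) ↔ L.Alive u := by
  refine forall₂_congr fun j hj => ?_
  rw [Function.update_of_ne]
  intro h
  have := i.2
  have h := congrArg Fin.val h
  simp only [main] at h
  omega

theorem update_main_flagPos (u : Cube n) (i : Fin L.m) (v s : Bool) :
    Function.update u (L.main i) v (L.flagPos s) = u (L.flagPos s) :=
  Function.update_of_ne (main_ne_flagPos i s).symm _ _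

/-- Exchanging the two flags. -/
def swapFlags (L : Layout n) : Cube n ≃ Cube n :=
  (Equiv.swap (L.flagPos false) (L.flagPos true)).arrowCongr (Equiv.refl Bool)

theorem swapFlags_flagPos (u : Cube n) (s : Bool) :
    L.swapFlags u (L.flagPos s) = u (L.flagPos !s) := by
  cases s <;> simp [swapFlags]

theorem swapFlags_of_ne {u : Cube n} {i : Fin n} (h : ∀ s, i ≠ L.flagPos s) :
    L.swapFlags u i = u i := by
  simp [swapFlags, Equiv.swap_apply_of_ne_of_ne (h false) (h true)]

theorem ones_swapFlags (u : Cube n) : L.ones (L.swapFlags u) = L.ones u := by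
  ext i
  simp [swapFlags_of_ne (main_ne_flagPos i)]

theorem alive_swapFlags {u : Cube n} : L.Alive (L.swapFlags u) ↔ L.Alive u := by
  refine forall₂_congr fun j hj => ?_
  rw [swapFlags_of_ne]
  intro s h
  have h := congrArg Fin.val h
  simp only [flagPos] at h
  cases s <;> simp at h <;> omega

end Layout

/-! ### Truncated Talagrand functions and their numbers of satisfying assignments -/

section truncatedTalagrand

variable {n : ℕ} (L : Layout n) (k : ℕ) {ι : Type*} (R : Finset ι)
  (T : ι → Finset (Fin L.m)) (pay : ι → Finset (Fin L.m) → Bool)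

/-- The terms with index in `R` that `X` satisfies. -/
def satisfied (X : Finset (Fin L.m)) : Finset ι := R.filter fun j => T j ⊆ X

/-- A Talagrand-style function with terms `T`, truncated above level `k` and relevant on
the levels `k - 1` and `k` only. Where exactly one term is satisfied, its value is that of `pay`,
complemented if the second of the two flags is set. -/
def truncatedTalagrandSat (u : Cube n) : Prop :=
  L.Alive u ∧ #(L.ones u) ≤ k ∧ (∃ s, u (L.flagPos s) = false) ∧
    ((∀ s, u (L.flagPos s) = false) ∨ #(L.ones u) + 1 < k ∨ satisfied L R T (L.ones u) = ∅ ∨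
      ∃ j, satisfied L R T (L.ones u) = {j} ∧ pay j (L.ones u) ≠ u (L.flagPos true))

open Classical in
/-- The Boolean function of `truncatedTalagrandSat`. -/
noncomputable def truncatedTalagrand (u : Cube n) : Bool :=
  decide (truncatedTalagrandSat L k R T pay u)

variable {L k R T pay}

theorem truncatedTalagrand_eq_true {u : Cube n} :
    truncatedTalagrand L k R T pay u = true ↔ truncatedTalagrandSat L k R T pay u := by
  simp [truncatedTalagrand]

theorem mem_satSet_truncatedTalagrand {u : Cube n} :
    u ∈ satSet (truncatedTalagrand L k R T pay) ↔ truncatedTalagrandSat L k R T pay u := by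
  rw [satSet, mem_filter, truncatedTalagrand_eq_true]
  simp

theorem satisfied_mono {X Y : Finset (Fin L.m)} (h : X ⊆ Y) :
    satisfied L R T X ⊆ satisfied L R T Y := fun j hj => by
  simp only [satisfied, mem_filter] at hj ⊢
  exact ⟨hj.1, hj.2.trans h⟩

theorem satisfied_subset {R' : Finset ι} (h : R' ⊆ R) (X : Finset (Fin L.m)) :
    satisfied L R' T X ⊆ satisfied L R T X :=
  filter_subset_filter _ h

theorem eq_empty_or_singleton_of_subset {α : Type*} {s : Finset α} {p : α → Prop} {t : Finset α}
    (hts : t ⊆ s) (h : s = ∅ ∨ ∃ j, s = {j} ∧ p j) : t = ∅ ∨ ∃ j, t = {j} ∧ p j := by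
  rcases h with rfl | ⟨j, rfl, hj⟩
  · exact Or.inl (subset_empty.1 hts)
  · rcases subset_singleton_iff.1 hts with h | h
    · exact Or.inl h
    · exact Or.inr ⟨j, h, hj⟩

/-- With a payload that is constant on each term, the function is decreasing. -/
theorem truncatedTalagrandSat_of_le {β : ι → Bool} {u v : Cube n} (huv : u ≤ v)
    (h : truncatedTalagrandSat L k R T (fun j _ => β j) v) :
    truncatedTalagrandSat L k R T (fun j _ => β j) u := by
  have hff : ∀ i, v i = false → u i = false := fun i hi => by
    have := huv i; rw [hi] at this; exact le_bot_iff.1 this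
  have hX : L.ones u ⊆ L.ones v := fun i hi => by
    rw [Layout.mem_ones] at hi ⊢
    have := huv (L.main i); rw [hi] at this; exact top_le_iff.1 this
  obtain ⟨h1, h2, ⟨s, h3⟩, h4⟩ := h
  refine ⟨fun i hi => hff _ (h1 i hi), (card_le_card hX).trans h2, ⟨s, hff _ h3⟩, ?_⟩
  by_cases hz : ∀ s, u (L.flagPos s) = false
  · exact Or.inl hz
  right
  rcases h4 with h4 | h4 | h4
  · exact absurd (fun s => hff _ (h4 s)) hz
  · exact Or.inl (lt_of_le_of_lt (by gcongr) h4)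
  · right
    -- Here `u ≤ v`, `u` has some flag set and `v` has some flag unset, so both have exactly one
    -- flag set, the same one.
    have heq : u (L.flagPos true) = v (L.flagPos true) := by
      cases s with
      | true => rw [h3, hff _ h3]
      | false =>
        have h5 : u (L.flagPos true) = true := by
          by_contra h5
          exact hz fun s => by
            cases s
            · exact hff _ h3
            · simpa using h5
        rw [h5]
        by_contra h6
        have := hff (L.flagPos true) (by simpa using Ne.symm h6)
        rw [this] at h5
        exact absurd h5 (by simp)
    simp only [heq]
    exact eq_empty_or_singleton_of_subset (satisfied_mono hX) h4

theorem truncatedTalagrand_mem_unate (β : ι → Bool) :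
    truncatedTalagrand L k R T (fun j _ => β j) ∈ unate n := by
  intro i
  right
  intro x
  rw [Bool.le_iff_imp, truncatedTalagrand_eq_true, truncatedTalagrand_eq_true]
  exact truncatedTalagrandSat_of_le
    (update_le_update_iff.2 ⟨Bool.false_le _, fun j _ => le_rfl⟩)

/-- Several satisfied terms give `0` and none gives `1`, so erasing terms never destroys a
satisfying assignment. This lets the sample distribution be compared with the one in which a term
has been erased. -/
theorem truncatedTalagrandSat_subset {R' : Finset ι} (hR : R' ⊆ R) {u : Cube n}
    (h : truncatedTalagrandSat L k R T pay u) : truncatedTalagrandSat L k R' T pay u := by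
  obtain ⟨h1, h2, h3, h4 | h4 | h4⟩ := h
  · exact ⟨h1, h2, h3, Or.inl h4⟩
  · exact ⟨h1, h2, h3, Or.inr (Or.inl h4)⟩
  · exact ⟨h1, h2, h3,
      Or.inr (Or.inr (eq_empty_or_singleton_of_subset (satisfied_subset hR _) h4))⟩

theorem truncatedTalagrand_congr {T' : ι → Finset (Fin L.m)} (h : ∀ j ∈ R, T j = T' j) :
    truncatedTalagrand L k R T pay = truncatedTalagrand L k R T' pay := by
  have : satisfied L R T = satisfied L R T' := by
    ext X j
    simp only [satisfied, mem_filter]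
    exact and_congr_right fun hj => by rw [h j hj]
  unfold truncatedTalagrand truncatedTalagrandSat
  rw [this]

/-- The number of satisfying assignments does not depend on the payload. -/
theorem card_satSet_truncatedTalagrand_eq (pay pay' : ι → Finset (Fin L.m) → Bool) :
    #(satSet (truncatedTalagrand L k R T pay)) = #(satSet (truncatedTalagrand L k R T pay')) := by
  classical
  have key : ∀ p : ι → Finset (Fin L.m) → Bool, 2 * #(satSet (truncatedTalagrand L k R T p))
      = ∑ u : Cube n, ((if truncatedTalagrandSat L k R T p u then 1 else 0)
          + if truncatedTalagrandSat L k R T p (L.swapFlags u) then 1 else 0) := by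
    intro p
    rw [sum_add_distrib,
      Equiv.sum_comp L.swapFlags fun u => if truncatedTalagrandSat L k R T p u then 1 else 0,
      ← two_mul, sum_boole]
    congr 2
    ext u
    simp [satSet, truncatedTalagrand]
  -- At an alive point on the top two levels with exactly one satisfied term and exactly one flag
  -- set, exactly one of `u` and its swap is satisfying, whatever the payload. Elsewhere the payload
  -- has no influence.
  have : ∀ u : Cube n, ((if truncatedTalagrandSat L k R T pay u then 1 else 0)
          + if truncatedTalagrandSat L k R T pay (L.swapFlags u) then 1 else 0)
        = ((if truncatedTalagrandSat L k R T pay' u then 1 else 0)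
          + if truncatedTalagrandSat L k R T pay' (L.swapFlags u) then 1 else 0) := by
    intro u
    simp only [truncatedTalagrandSat, Layout.alive_swapFlags, Layout.ones_swapFlags,
      Layout.swapFlags_flagPos, Bool.exists_bool, Bool.forall_bool, Bool.not_true, Bool.not_false]
    by_cases hj : ∃ j, satisfied L R T (L.ones u) = {j}
    · obtain ⟨j, hj⟩ := hj
      simp only [hj, singleton_ne_empty, singleton_inj, exists_eq_left', false_or]
      cases u (L.flagPos true) <;> cases u (L.flagPos false) <;> cases pay j (L.ones u) <;>
        cases pay' j (L.ones u) <;> simp [add_comm]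
    · have h' : ∀ (q : ι → Prop), (∃ j, satisfied L R T (L.ones u) = {j} ∧ q j) ↔ False :=
        fun q => ⟨fun ⟨j, h, _⟩ => hj ⟨j, h⟩, False.elim⟩
      simp only [h']
  have h := key pay
  rw [sum_congr rfl fun u _ => this u, ← key pay'] at h
  omega

theorem card_filter_card_eq (m l : ℕ) : #{X : Finset (Fin m) | #X = l} = m.choose l := by
  have : ({X : Finset (Fin m) | #X = l} : Finset _) = powersetCard l univ := by
    ext; simp [mem_powersetCard]
  rw [this, card_powersetCard, card_fin]

theorem two_mul_choose_le {m k : ℕ} (h : 3 * (k + 1) ≤ m) :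
    2 * m.choose k ≤ m.choose (k + 1) := by
  have h1 := Nat.choose_succ_right_eq m k
  have h2 : 2 * (k + 1) ≤ m - k := by omega
  have h3 : m.choose k * (2 * (k + 1)) ≤ m.choose k * (m - k) := Nat.mul_le_mul_left _ h2
  rw [← h1] at h3
  nlinarith

theorem card_filter_card_le (m k : ℕ) (h : 3 * k ≤ m) :
    #{X : Finset (Fin m) | #X ≤ k} ≤ 2 * m.choose k := by
  induction k with
  | zero =>
    have := card_filter_card_eq m 0
    simp only [Nat.le_zero]
    omega
  | succ k ih =>
    have h1 := ih (by omega)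
    have h2 := two_mul_choose_le h
    have h3 : ({X : Finset (Fin m) | #X ≤ k + 1} : Finset _)
        = ({X : Finset (Fin m) | #X ≤ k} : Finset _) ∪ ({X : Finset (Fin m) | #X = k + 1} : Finset _) := by
      ext X
      simp only [mem_filter, mem_union, mem_univ, true_and]
      exact Nat.le_succ_iff
    rw [h3]
    refine (card_union_le _ _).trans ?_
    rw [card_filter_card_eq]
    omega

theorem card_filter_superset (m l : ℕ) (τ : Finset (Fin m)) :
    #{X : Finset (Fin m) | #X = l ∧ τ ⊆ X} ≤ (m - #τ).choose (l - #τ) := by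
  have : #(powersetCard (l - #τ) τᶜ) = (m - #τ).choose (l - #τ) := by
    rw [card_powersetCard, card_compl, Fintype.card_fin]
  rw [← this]
  refine card_le_card_of_injOn (fun X => X \ τ) ?_ ?_
  · intro X hX
    simp only [coe_filter, mem_univ, true_and, Set.mem_ofPred_eq] at hX
    rw [mem_coe, mem_powersetCard]
    refine ⟨fun i hi => by simpa using (mem_sdiff.1 hi).2, ?_⟩
    rw [card_sdiff_of_subset hX.2, hX.1]
  · intro X hX Y hY hXY
    simp only [coe_filter, mem_univ, true_and, Set.mem_ofPred_eq] at hX hY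
    rw [← sdiff_union_of_subset hX.2, ← sdiff_union_of_subset hY.2]
    exact congrArg (· ∪ τ) hXY

open Classical in
theorem choose_mul_le_card_satSet :
    L.m.choose k * 2 ^ L.b ≤ #(satSet (truncatedTalagrand L k R T pay)) := by
  rw [← card_filter_card_eq,
    ← Layout.card_filter_alive (fun _ => false) fun X : Finset (Fin L.m) => #X = k]
  refine card_le_card fun u hu => ?_
  simp only [mem_filter, mem_univ, true_and] at hu
  rw [mem_satSet_truncatedTalagrand]
  exact ⟨hu.1, hu.2.2.le, ⟨true, hu.2.1 _⟩, Or.inl hu.2.1⟩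

open Classical in
theorem card_satSet_le (h : 3 * k ≤ L.m) :
    #(satSet (truncatedTalagrand L k R T pay)) ≤ 6 * (L.m.choose k * 2 ^ L.b) := by
  set A : (Bool → Bool) → Finset (Cube n) := fun c =>
    {u : Cube n | L.Alive u ∧ (∀ s, u (L.flagPos s) = c s) ∧ #(L.ones u) ≤ k} with hA
  have hcard : ∀ c, #(A c) ≤ 2 * L.m.choose k * 2 ^ L.b := fun c => by
    refine (Layout.card_filter_alive c fun X => #X ≤ k).le.trans ?_
    exact Nat.mul_le_mul_right _ (card_filter_card_le _ _ h)
  -- Three of the four flag patterns allow the value `1`, each on at most `2 * L.m.choose k` main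
  -- parts; hence the factor `6`.
  have hsub : satSet (truncatedTalagrand L k R T pay)
      ⊆ A (fun _ => false) ∪ (A id ∪ A not) := by
    intro u hu
    rw [mem_satSet_truncatedTalagrand] at hu
    obtain ⟨h1, h2, h3, -⟩ := hu
    simp only [hA, mem_union, mem_filter, mem_univ, true_and, h1, h2, and_true, Bool.exists_bool,
      Bool.forall_bool, id, Bool.not_true, Bool.not_false] at h3 ⊢
    revert h3
    cases u (L.flagPos true) <;> cases u (L.flagPos false) <;> simp
  calc _ ≤ _ := card_le_card hsub
    _ ≤ _ := (card_union_le _ _).trans (Nat.add_le_add_left (card_union_le _ _) _)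
    _ ≤ _ := by
      have h1 := hcard (fun _ => false)
      have h2 := hcard id
      have h3 := hcard not
      rw [mul_assoc] at h1 h2 h3
      omega

open Classical in
/-- Dropping the term `j` changes the function only above `T j`. -/
theorem card_satSet_erase_le [DecidableEq ι] (j : ι) :
    #(satSet (truncatedTalagrand L k (R.erase j) T pay))
      ≤ #(satSet (truncatedTalagrand L k R T pay))
        + 2 * (((L.m - #(T j)).choose (k - #(T j)) + (L.m - #(T j)).choose (k - 1 - #(T j)))
            * 2 ^ L.b) := by
  set P : Finset (Fin L.m) → Prop := fun X => (#X = k ∨ #X = k - 1) ∧ T j ⊆ X with hP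
  set A : (Bool → Bool) → Finset (Cube n) := fun c =>
    {u : Cube n | L.Alive u ∧ (∀ s, u (L.flagPos s) = c s) ∧ P (L.ones u)} with hA
  have hPc : #{X | P X}
      ≤ (L.m - #(T j)).choose (k - #(T j)) + (L.m - #(T j)).choose (k - 1 - #(T j)) := by
    refine le_trans ?_ (add_le_add (card_filter_superset L.m k (T j))
      (card_filter_superset L.m (k - 1) (T j)))
    refine le_trans (card_le_card fun X hX => ?_) (card_union_le _ _)
    simp only [hP, mem_filter, mem_univ, true_and, mem_union] at hX ⊢
    tauto
  have hcard : ∀ c, #(A c) ≤ ((L.m - #(T j)).choose (k - #(T j))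
      + (L.m - #(T j)).choose (k - 1 - #(T j))) * 2 ^ L.b := fun c =>
    (Layout.card_filter_alive c P).le.trans (Nat.mul_le_mul_right _ hPc)
  have hsub : satSet (truncatedTalagrand L k (R.erase j) T pay)
      ⊆ satSet (truncatedTalagrand L k R T pay) ∪ (A id ∪ A not) := by
    intro u hu
    rw [mem_union, mem_satSet_truncatedTalagrand]
    rw [mem_satSet_truncatedTalagrand] at hu
    by_cases hPu : P (L.ones u) ∧ ¬ ∀ s, u (L.flagPos s) = false
    · right
      obtain ⟨h1, h2, h3, -⟩ := hu
      simp only [hA, mem_union, mem_filter, mem_univ, true_and, h1, hPu.1, and_true,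
        Bool.exists_bool, Bool.forall_bool, id, Bool.not_true, Bool.not_false] at h3 hPu ⊢
      revert h3 hPu
      cases u (L.flagPos true) <;> cases u (L.flagPos false) <;> simp
    · left
      obtain ⟨h1, h2, h3, h4⟩ := hu
      refine ⟨h1, h2, h3, ?_⟩
      by_cases hz : ∀ s, u (L.flagPos s) = false
      · exact Or.inl hz
      by_cases hl : #(L.ones u) + 1 < k
      · exact Or.inr (Or.inl hl)
      have hT : ¬ T j ⊆ L.ones u := fun hT => hPu ⟨⟨by omega, hT⟩, hz⟩
      have : satisfied L (R.erase j) T (L.ones u) = satisfied L R T (L.ones u) := by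
        ext i
        simp only [satisfied, mem_filter, mem_erase]
        constructor
        · rintro ⟨⟨-, h⟩, h'⟩
          exact ⟨h, h'⟩
        · rintro ⟨h, h'⟩
          exact ⟨⟨fun e => hT (e ▸ h'), h⟩, h'⟩
      rwa [this] at h4
  calc _ ≤ _ := card_le_card hsub
    _ ≤ _ := (card_union_le _ _).trans (Nat.add_le_add_left (card_union_le _ _) _)
    _ ≤ _ := by
      have h2 := hcard id
      have h3 := hcard not
      omega

end truncatedTalagrand

/-! ### Coupling two families of functions with equally many satisfying assignments -/

section coupling

variable {n : ℕ} {B : Type*} [Fintype B]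

open Classical in
/-- The total, over a finite family of functions, of the expectations of payoffs, restricted to the
functions that are `1` at all the given samples. -/
noncomputable def totalPayoff (f : B → Cube n → Bool) (G : B → Payoff n) (A : NonadaptiveAlg n)
    (h : List (Cube n)) : ℝ :=
  ∑ β with ∀ x ∈ h, f β x = true, expectedPayoff (f β) (G β) A h

theorem totalPayoff_nil (f : B → Cube n → Bool) (G : B → Payoff n) (A : NonadaptiveAlg n) :
    totalPayoff f G A [] = ∑ β, expectedPayoff (f β) (G β) A [] := by
  simp [totalPayoff]

/-- Restricting to the functions consistent with the samples turns a sum over `f β ⁻¹(1)`, which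
depends on `β`, into a sum over all points. With a common size `Z`, the two families can then be
compared sample by sample. -/
theorem totalPayoff_sample {f : B → Cube n → Bool} {Z : ℕ} (hZ : ∀ β, #(satSet (f β)) = Z)
    (G : B → Payoff n) (next : Cube n → NonadaptiveAlg n) (h : List (Cube n)) :
    totalPayoff f G (.sample next) h = (∑ x, totalPayoff f G (next x) (x :: h)) / Z := by
  classical
  simp only [totalPayoff, expectedPayoff, hZ]
  rw [← sum_div]
  congr 1
  simp only [satSet, sum_filter, List.forall_mem_cons]
  rw [sum_comm]
  refine sum_congr rfl fun β _ => ?_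
  by_cases hβ : ∀ x ∈ h, f β x = true
  · rw [if_pos hβ]
    exact sum_congr rfl fun x _ => if_congr (and_iff_left hβ).symm rfl rfl
  · simp [hβ]

/-- If outside of the event `Bad` the two families agree, after relabeling, at all points seen by
the algorithm, then its acceptance probabilities differ by at most that of `Bad`. -/
theorem totalPayoff_accept_le {f g : B → Cube n → Bool} {Z : ℕ}
    (hf : ∀ β, #(satSet (f β)) = Z) (hg : ∀ β, #(satSet (g β)) = Z)
    (Bad : List (Cube n) → Prop) [DecidablePred Bad]
    (hBad : ∀ pts, ¬ Bad pts → ∃ σ : B ≃ B, ∀ β, ∀ P ∈ pts, g β P = f (σ β) P)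
    (A : NonadaptiveAlg n) (h : List (Cube n)) :
    totalPayoff f (fun β => acceptPayoff (f β)) A h
      ≤ totalPayoff g (fun β => acceptPayoff (g β)) A h
        + totalPayoff f (fun _ h pts _ => if Bad (h ++ pts) then 1 else 0) A h := by
  classical
  induction A generalizing h with
  | query pts a =>
    by_cases hb : Bad (h ++ pts)
    · have h1 : 0 ≤ totalPayoff g (fun β => acceptPayoff (g β)) (.query pts a) h :=
        sum_nonneg fun β _ => acceptPayoff_nonneg _ h pts a
      refine le_trans ?_ (le_add_of_nonneg_left h1)
      refine sum_le_sum fun β _ => ?_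
      simp only [expectedPayoff, acceptPayoff, if_pos hb]
      split_ifs <;> norm_num
    · obtain ⟨σ, hσ⟩ := hBad _ hb
      refine le_add_of_le_of_nonneg (le_of_eq ?_)
        (sum_nonneg fun β _ => by simp only [expectedPayoff, if_neg hb, le_refl])
      simp only [totalPayoff, expectedPayoff, acceptPayoff, sum_filter]
      rw [← Equiv.sum_comp σ]
      refine sum_congr rfl fun β _ => ?_
      have h1 : pts.map (g β) = pts.map (f (σ β)) :=
        List.map_congr_left fun P hP => hσ β P (List.mem_append_right _ hP)
      have h2 : (∀ x ∈ h, f (σ β) x = true) ↔ ∀ x ∈ h, g β x = true :=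
        forall₂_congr fun x hx => by rw [hσ β x (List.mem_append_left _ hx)]
      simp only [h1, h2]
  | sample next ih =>
    rw [totalPayoff_sample hf, totalPayoff_sample hg, totalPayoff_sample hf, ← add_div,
      ← sum_add_distrib]
    exact div_le_div_of_nonneg_right (sum_le_sum fun x _ => ih x _) (Nat.cast_nonneg _)

end coupling

/-! ### The unate family, the far family, and the event that separates them -/

section payloads

variable {n : ℕ} (L : Layout n) (k : ℕ) {ι : Type*} [Fintype ι]
  (T : ι → Finset (Fin L.m))

/-- The function that is constant on each term. -/
noncomputable def constantOnTerms (R : Finset ι) (β : ι → Bool) : Cube n → Bool :=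
  truncatedTalagrand L k R T fun j _ => β j

/-- The function that on the term `j` is the literal, of sign `β j`, of the variable `v j`. -/
noncomputable def literalOnTerms (v : ι → Fin L.m) (β : ι → Bool) : Cube n → Bool :=
  truncatedTalagrand L k univ T fun j X => xor (β j) (decide (v j ∈ X))

open Classical in
/-- The main coordinates in which two of the given points satisfying the term `τ` differ. -/
noncomputable def disagreement (τ : Finset (Fin L.m)) (pts : List (Cube n)) : Finset (Fin L.m) :=
  {i | ∃ P ∈ pts, ∃ Q ∈ pts, (#(L.ones P) ≤ k ∧ τ ⊆ L.ones P) ∧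
    (#(L.ones Q) ≤ k ∧ τ ⊆ L.ones Q) ∧ i ∈ L.ones P ∧ i ∉ L.ones Q}

variable {L k T}

/-- On the seen points of term `j` the variable `v j` takes a single value `c j`, so there the
literal is the constant `xor (β j) (c j)`. Flipping `β` by `c` is an involution. -/
theorem exists_relabeling {v : ι → Fin L.m} {pts : List (Cube n)}
    (h : ∀ j, v j ∉ disagreement L k (T j) pts) :
    ∃ σ : (ι → Bool) ≃ (ι → Bool), ∀ β, ∀ P ∈ pts,
      literalOnTerms L k T v β P = constantOnTerms L k T univ (σ β) P := by
  classical
  let c : ι → Bool := fun j =>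
    decide (∃ P ∈ pts, (#(L.ones P) ≤ k ∧ T j ⊆ L.ones P) ∧ v j ∈ L.ones P)
  have hinv : Function.Involutive fun β : ι → Bool => fun j => xor (β j) (c j) := fun β => by
    funext j; simp
  refine ⟨hinv.toPerm, fun β P hP => ?_⟩
  have hc : ∀ j, #(L.ones P) ≤ k → T j ⊆ L.ones P → c j = decide (v j ∈ L.ones P) := by
    intro j h1 h2
    simp only [c, decide_eq_decide]
    constructor
    · rintro ⟨Q, hQ, hQ1, hQ2⟩
      by_contra hv
      exact h j (by
        simp only [disagreement, mem_filter, mem_univ, true_and]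
        exact ⟨Q, hQ, P, hP, hQ1, ⟨h1, h2⟩, hQ2, hv⟩)
    · exact fun hv => ⟨P, hP, ⟨h1, h2⟩, hv⟩
  rw [Bool.eq_iff_iff, literalOnTerms, constantOnTerms, truncatedTalagrand_eq_true,
    truncatedTalagrand_eq_true]
  simp only [truncatedTalagrandSat, Function.Involutive.coe_toPerm]
  refine and_congr_right fun _ => and_congr_right fun h1 => and_congr_right fun _ =>
    or_congr_right (or_congr_right (or_congr_right (exists_congr fun j =>
      and_congr_right fun hj => ?_)))
  have hj : j ∈ satisfied L univ T (L.ones P) := by rw [hj]; exact mem_singleton_self _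
  rw [hc j h1 (mem_filter.1 hj).2]

open Classical in
theorem sum_acceptProb_le [DecidableEq ι] (v : ι → Fin L.m) (A : NonadaptiveAlg n) :
    ∑ β, acceptProb (constantOnTerms L k T univ β) A
      ≤ ∑ β, acceptProb (literalOnTerms L k T v β) A
        + ∑ β, expectedPayoff (constantOnTerms L k T univ β) (fun h pts _ =>
            if ∃ j, v j ∈ disagreement L k (T j) (h ++ pts) then 1 else 0) A [] := by
  have := totalPayoff_accept_le (f := constantOnTerms L k T univ) (g := literalOnTerms L k T v)
    (Z := #(satSet (constantOnTerms L k T univ fun _ => false)))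
    (fun β => card_satSet_truncatedTalagrand_eq _ _)
    (fun β => card_satSet_truncatedTalagrand_eq _ _)
    (fun pts => ∃ j, v j ∈ disagreement L k (T j) pts)
    (fun pts h => exists_relabeling (not_exists.1 h)) A []
  simpa only [totalPayoff_nil, acceptProb] using this

end payloads

/-! ### Resampling one entry, and random terms against fixed points -/

theorem sum_sum_update {ι α : Type*} [Fintype ι] [DecidableEq ι] [Fintype α] (j : ι)
    (F : (ι → α) → ℝ) :
    ∑ f, ∑ a, F (Function.update f j a) = Fintype.card α * ∑ f, F f := by
  have hinv : Function.Involutive fun p : (ι → α) × α => (Function.update p.1 j p.2, p.1 j) := by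
    rintro ⟨f, a⟩
    simp
  have := Equiv.sum_comp hinv.toPerm fun p : (ι → α) × α => F p.1
  rw [Fintype.sum_prod_type, Fintype.sum_prod_type] at this
  simpa [← mul_sum] using this

theorem card_mul_sum_apply {ι α : Type*} [Fintype ι] [DecidableEq ι] [Fintype α] (j : ι)
    (g : α → ℝ) :
    Fintype.card α * ∑ f : ι → α, g (f j) = Fintype.card (ι → α) * ∑ a, g a := by
  rw [← sum_sum_update j fun f => g (f j)]
  simp

/-- A random half of a `2t`-set avoids `r` given elements with probability at most `2 ^ (-r)`: by
Pascal's rule, each removal of an element at least halves the count. -/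
theorem two_pow_mul_choose_le {t r : ℕ} (h : r ≤ 2 * t) :
    2 ^ r * (2 * t - r).choose t ≤ (2 * t).choose t := by
  induction r with
  | zero => simp
  | succ r ih =>
    refine le_trans ?_ (ih (by omega))
    rw [pow_succ, mul_assoc]
    refine Nat.mul_le_mul_left _ ?_
    obtain ⟨a, ha⟩ : ∃ a, 2 * t - r = a + 1 := ⟨2 * t - r - 1, by omega⟩
    obtain ⟨s, rfl⟩ : ∃ s, t = s + 1 := ⟨t - 1, by omega⟩
    have h2 : 2 * (s + 1) - (r + 1) = a := by omega
    rw [ha, h2, Nat.choose_succ_succ']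
    have h3 := Nat.choose_succ_right_eq a s
    have h4 : a.choose s * (a - s) ≤ a.choose s * (s + 1) := Nat.mul_le_mul_left _ (by omega)
    rw [← h3] at h4
    have := Nat.le_of_mul_le_mul_right h4 (by omega)
    omega

/-- The type of terms with `t` variables among `m`. -/
abbrev Term (m t : ℕ) : Type := {τ : Finset (Fin m) // #τ = t}

theorem card_term (m t : ℕ) : Fintype.card (Term m t) = m.choose t := by
  simp [Term]

theorem card_filter_term_subset {m t : ℕ} (X : Finset (Fin m)) :
    #{τ : Term m t | τ.1 ⊆ X} = (#X).choose t := by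
  rw [← card_powersetCard, ← card_map (Function.Embedding.subtype _)]
  congr 1
  ext τ
  simp [mem_powersetCard, and_comm]

section disagreement

variable {n : ℕ} {L : Layout n} {k : ℕ}

open Classical in
-- If two points of `τ` have an intersection of size at most `k - r`, the second sum already
-- contributes `L.m`. Otherwise fix one point `P` of `τ`: each disagreement lies in the symmetric
-- difference of `P` and another point of `τ`, which has size at most `2 * r`.
theorem card_disagreement_le (τ : Finset (Fin L.m)) (pts : List (Cube n)) {r : ℕ} (S)
    (hS : S = pts.toFinset.filter fun P => #(L.ones P) ≤ k) :
    #(disagreement L k τ pts) ≤ ∑ P ∈ S, (if τ ⊆ L.ones P then 2 * r else 0)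
      + ∑ P ∈ S, ∑ Q ∈ S, if #(L.ones P ∩ L.ones Q) + r ≤ k ∧ τ ⊆ L.ones P ∩ L.ones Q
          then L.m else 0 := by
  have hmem : ∀ P, P ∈ S ↔ P ∈ pts ∧ #(L.ones P) ≤ k := fun P => by
    rw [hS, mem_filter, List.mem_toFinset]
  by_cases hfar : ∃ P ∈ S, ∃ Q ∈ S,
      #(L.ones P ∩ L.ones Q) + r ≤ k ∧ τ ⊆ L.ones P ∩ L.ones Q
  · obtain ⟨P, hP, Q, hQ, h⟩ := hfar
    refine le_trans ((card_le_univ _).trans_eq (Fintype.card_fin _)) (le_add_left ?_)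
    calc L.m = if #(L.ones P ∩ L.ones Q) + r ≤ k ∧ τ ⊆ L.ones P ∩ L.ones Q
          then L.m else 0 := by rw [if_pos h]
      _ ≤ _ := single_le_sum
          (f := fun Q => if #(L.ones P ∩ L.ones Q) + r ≤ k ∧ τ ⊆ L.ones P ∩ L.ones Q
            then L.m else 0) (fun _ _ => Nat.zero_le _) hQ
      _ ≤ _ := single_le_sum (f := fun P => ∑ Q ∈ S,
            if #(L.ones P ∩ L.ones Q) + r ≤ k ∧ τ ⊆ L.ones P ∩ L.ones Q
              then L.m else 0) (fun _ _ => Nat.zero_le _) hP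
  · refine le_add_right ?_
    push Not at hfar
    rw [← sum_filter]
    by_cases hne : ∃ P, P ∈ S.filter fun P => τ ⊆ L.ones P
    · obtain ⟨P, hP⟩ := hne
      rw [mem_filter] at hP
      have hsub : disagreement L k τ pts ⊆ (S.filter fun P => τ ⊆ L.ones P).biUnion
          fun Q => symmDiff (L.ones P) (L.ones Q) := by
        intro i hi
        simp only [disagreement, mem_filter, mem_univ, true_and] at hi
        obtain ⟨Q, hQ, Q', hQ', h1, h2, h3, h4⟩ := hi
        rw [mem_biUnion]
        by_cases hiP : i ∈ L.ones P
        · exact ⟨Q', mem_filter.2 ⟨(hmem _).2 ⟨hQ', h2.1⟩, h2.2⟩,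
            mem_symmDiff.2 (Or.inl ⟨hiP, h4⟩)⟩
        · exact ⟨Q, mem_filter.2 ⟨(hmem _).2 ⟨hQ, h1.1⟩, h1.2⟩,
            mem_symmDiff.2 (Or.inr ⟨h3, hiP⟩)⟩
      refine (card_le_card hsub).trans (card_biUnion_le.trans (sum_le_sum fun Q hQ => ?_))
      rw [mem_filter] at hQ
      have h1 : ¬ #(L.ones P ∩ L.ones Q) + r ≤ k := fun h =>
        hfar P hP.1 Q hQ.1 h (subset_inter hP.2 hQ.2)
      have h2 := ((hmem _).1 hP.1).2
      have h3 := ((hmem _).1 hQ.1).2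
      have h4 := card_sdiff_add_card_inter (L.ones P) (L.ones Q)
      have h5 := card_sdiff_add_card_inter (L.ones Q) (L.ones P)
      rw [inter_comm] at h5
      have h6 : #(symmDiff (L.ones P) (L.ones Q))
          ≤ #(L.ones P \ L.ones Q) + #(L.ones Q \ L.ones P) := card_union_le _ _
      omega
    · have : disagreement L k τ pts = ∅ := by
        refine eq_empty_of_forall_notMem fun i hi => ?_
        simp only [disagreement, mem_filter, mem_univ, true_and] at hi
        obtain ⟨Q, hQ, Q', hQ', h1, h2, h3, h4⟩ := hi
        exact hne ⟨Q, mem_filter.2 ⟨(hmem _).2 ⟨hQ, h1.1⟩, h1.2⟩⟩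
      simp [this]

/-- A random term separates few pairs of coordinates among `q` points. -/
theorem sum_card_disagreement_le {t r q : ℕ} (hq : q ≤ L.m) (hr : L.m * L.m ≤ 2 ^ r)
    (pts : List (Cube n)) (hpts : pts.length ≤ q) :
    ∑ τ : Term L.m t, #(disagreement L (2 * t) τ.1 pts)
      ≤ (2 * t).choose t * (q * (2 * r + 1)) := by
  classical
  obtain ⟨S, hS⟩ : ∃ S, S = pts.toFinset.filter fun P => #(L.ones P) ≤ 2 * t := ⟨_, rfl⟩
  have hSk : ∀ P ∈ S, #(L.ones P) ≤ 2 * t := fun P hP => by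
    rw [hS] at hP; exact (mem_filter.1 hP).2
  have hSq : #S ≤ q := by
    rw [hS]
    exact (card_filter_le _ _).trans ((List.toFinset_card_le _).trans hpts)
  have hnear : ∀ P ∈ S, ∑ τ : Term L.m t, (if τ.1 ⊆ L.ones P then 2 * r else 0)
      ≤ (2 * t).choose t * (2 * r) := by
    intro P hP
    rw [← sum_filter, sum_const, card_filter_term_subset, smul_eq_mul]
    exact Nat.mul_le_mul_right _ (Nat.choose_le_choose _ (hSk P hP))
  have hfar : ∀ P ∈ S, ∀ Q ∈ S, 2 ^ r * ∑ τ : Term L.m t,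
      (if #(L.ones P ∩ L.ones Q) + r ≤ 2 * t ∧ τ.1 ⊆ L.ones P ∩ L.ones Q then L.m else 0)
      ≤ (2 * t).choose t * L.m := by
    intro P hP Q hQ
    by_cases h : #(L.ones P ∩ L.ones Q) + r ≤ 2 * t
    · simp only [h, true_and]
      rw [← sum_filter, sum_const, card_filter_term_subset, smul_eq_mul, ← mul_assoc]
      refine Nat.mul_le_mul_right _ (le_trans ?_ (two_pow_mul_choose_le (r := r) (by omega)))
      exact Nat.mul_le_mul_left _ (Nat.choose_le_choose _ (by omega))
    · simp [h]
  calc ∑ τ : Term L.m t, #(disagreement L (2 * t) τ.1 pts)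
      ≤ ∑ τ : Term L.m t, (∑ P ∈ S, (if τ.1 ⊆ L.ones P then 2 * r else 0)
        + ∑ P ∈ S, ∑ Q ∈ S, if #(L.ones P ∩ L.ones Q) + r ≤ 2 * t ∧ τ.1 ⊆ L.ones P ∩ L.ones Q
          then L.m else 0) := sum_le_sum fun τ _ => card_disagreement_le τ.1 pts S hS
    _ = ∑ P ∈ S, ∑ τ : Term L.m t, (if τ.1 ⊆ L.ones P then 2 * r else 0)
        + ∑ P ∈ S, ∑ Q ∈ S, ∑ τ : Term L.m t,
          (if #(L.ones P ∩ L.ones Q) + r ≤ 2 * t ∧ τ.1 ⊆ L.ones P ∩ L.ones Q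
            then L.m else 0) := by
        rw [sum_add_distrib, sum_comm]
        congr 1
        rw [sum_comm]
        exact sum_congr rfl fun P _ => sum_comm
    _ ≤ q * ((2 * t).choose t * (2 * r)) + q * (2 * t).choose t := by
        refine add_le_add ?_ ?_
        · refine (sum_le_card_nsmul _ _ _ hnear).trans ?_
          rw [smul_eq_mul]
          exact Nat.mul_le_mul_right _ hSq
        -- At most `q²` far pairs, each of weight `m` and probability reduced by `2 ^ r`: with `q ≤
        -- m` and `m² ≤ 2 ^ r` they add only the `+ 1` of `2 * r + 1`.
        · refine Nat.le_of_mul_le_mul_left ?_ (pow_pos two_pos r)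
          rw [mul_sum]
          calc _ ≤ #S • (#S • ((2 * t).choose t * L.m)) := by
                refine sum_le_card_nsmul _ _ _ fun P hP => ?_
                rw [mul_sum]
                exact sum_le_card_nsmul _ _ _ fun Q hQ => hfar P hP Q hQ
            _ ≤ q * (L.m * ((2 * t).choose t * L.m)) := by
                simp only [smul_eq_mul]
                gcongr
                exact hSq.trans hq
            _ = (L.m * L.m) * (q * (2 * t).choose t) := by ring
            _ ≤ _ := Nat.mul_le_mul_right _ hr
    _ = _ := by ring

end disagreement

/-! ### Leave-one-out: the separating event is unlikely -/

section leaveOneOut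

variable {n : ℕ} {L : Layout n} {t : ℕ}

/-- Dropping one term enlarges the set of satisfying assignments by a factor close to `1`. -/
theorem card_satSet_erase_le_mul {ι : Type*} [Fintype ι] [DecidableEq ι] (ht : 1 ≤ t)
    (hm : L.m = 6 * t) (T : ι → Term L.m t) (β : ι → Bool) (j : ι) :
    (#(satSet (constantOnTerms L (2 * t) (fun j => (T j).1) (univ.erase j) β)) : ℝ)
      ≤ (1 + 4 * ((2 * t).choose t / (6 * t).choose t))
        * #(satSet (constantOnTerms L (2 * t) (fun j => (T j).1) univ β)) := by
  have h1 := card_satSet_erase_le (L := L) (k := 2 * t) (R := univ) (T := fun j => (T j).1)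
    (pay := fun j _ => β j) j
  have h2 := choose_mul_le_card_satSet (L := L) (k := 2 * t) (R := univ) (T := fun j => (T j).1)
    (pay := fun j _ => β j)
  rw [(T j).2, show L.m - t = 5 * t by omega, show 2 * t - t = t by omega,
    show 2 * t - 1 - t = t - 1 by omega] at h1
  rw [show L.m.choose (2 * t) = (6 * t).choose (2 * t) by rw [hm]] at h2
  have h3 : (5 * t).choose (t - 1) ≤ (5 * t).choose t := by
    have := Nat.choose_le_succ_of_lt_half_left (n := 5 * t) (r := t - 1) (by omega)
    rwa [show t - 1 + 1 = t by omega] at this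
  -- Double counting of pairs (term, `2t`-set containing it): a given term lies in a fraction `p` of
  -- the sets of the top level.
  have h4 : (6 * t).choose (2 * t) * (2 * t).choose t = (6 * t).choose t * (5 * t).choose t := by
    have := Nat.choose_mul (n := 6 * t) (k := 2 * t) (s := t) (by omega)
    rwa [show 6 * t - t = 5 * t by omega, show 2 * t - t = t by omega] at this
  have h5 : (0 : ℝ) < (6 * t).choose t := by exact_mod_cast Nat.choose_pos (by omega)
  have h6 : ((5 * t).choose t : ℝ)
      = (6 * t).choose (2 * t) * ((2 * t).choose t / (6 * t).choose t) := by
    rw [mul_div_assoc', eq_div_iff h5.ne']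
    exact_mod_cast (h4.trans (mul_comm _ _)).symm
  set p : ℝ := (2 * t).choose t / (6 * t).choose t with hp
  have hp0 : 0 ≤ p := by positivity
  unfold constantOnTerms
  set Z := #(satSet (truncatedTalagrand L (2 * t) univ (fun j => (T j).1) fun j _ => β j))
  -- The `4` is two flag patterns times two levels, the lower level being no larger than the upper
  -- one.
  have h7 : (#(satSet (truncatedTalagrand L (2 * t) (univ.erase j) (fun j => (T j).1)
      fun j _ => β j)) : ℝ) ≤ Z + 4 * ((5 * t).choose t * 2 ^ L.b) := by
    have h8 : ((5 * t).choose t + (5 * t).choose (t - 1)) * 2 ^ L.b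
        ≤ (2 * (5 * t).choose t) * 2 ^ L.b := Nat.mul_le_mul_right _ (by omega)
    have h9 := h1.trans (Nat.add_le_add_left (Nat.mul_le_mul_left 2 h8) _)
    have h10 : ((_ : ℕ) : ℝ) ≤ ((_ : ℕ) : ℝ) := Nat.cast_le.2 h9
    push_cast at h10
    linarith
  have h8 : ((6 * t).choose (2 * t) : ℝ) * 2 ^ L.b ≤ Z := by exact_mod_cast h2
  have h9 := mul_le_mul_of_nonneg_left h8 hp0
  rw [h6] at h7
  linarith

open Classical in
-- Running on the function without term `j` costs a factor `ρ ^ q`. That run does not depend on `T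
-- j`, so `T j` may be drawn afterwards, and the bound for fixed points applies to each outcome of
-- the run.
theorem sum_expectedPayoff_disagreement_le {M q r : ℕ} (ht : 1 ≤ t) (hm : L.m = 6 * t)
    (hq : q ≤ L.m) (hr : L.m * L.m ≤ 2 ^ r) (A : NonadaptiveAlg n) (hA : A.MakesAtMost q)
    (β : Fin M → Bool) (j : Fin M) :
    ∑ T : Fin M → Term L.m t,
      expectedPayoff (constantOnTerms L (2 * t) (fun j => (T j).1) univ β)
        (fun h pts _ => (#(disagreement L (2 * t) (T j).1 (h ++ pts)) : ℝ)) A []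
      ≤ Fintype.card (Fin M → Term L.m t) *
        ((1 + 4 * ((2 * t).choose t / (6 * t).choose t)) ^ q
          * ((2 * t).choose t / (6 * t).choose t * (q * (2 * r + 1)))) := by
  have h5 : (0 : ℝ) < (6 * t).choose t := by exact_mod_cast Nat.choose_pos (by omega)
  have hne : ∀ R (T : Fin M → Term L.m t),
      (satSet (constantOnTerms L (2 * t) (fun j => (T j).1) R β)).Nonempty := by
    intro R T
    rw [← card_pos]
    refine lt_of_lt_of_le ?_ (choose_mul_le_card_satSet (k := 2 * t))
    exact Nat.mul_pos (Nat.choose_pos (by omega)) (by positivity)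
  set ρ : ℝ := 1 + 4 * ((2 * t).choose t / (6 * t).choose t) with hρ
  have hρ1 : 1 ≤ ρ := by rw [hρ]; exact le_add_of_nonneg_right (by positivity)
  set G : Term L.m t → Payoff n :=
    fun τ h pts _ => (#(disagreement L (2 * t) τ.1 (h ++ pts)) : ℝ) with hG
  set g : (Fin M → Term L.m t) → Cube n → Bool :=
    fun T => constantOnTerms L (2 * t) (fun j => (T j).1) (univ.erase j) β with hg
  have hstep : ∀ T : Fin M → Term L.m t,
      expectedPayoff (constantOnTerms L (2 * t) (fun j => (T j).1) univ β) (G (T j)) A []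
        ≤ ρ ^ q * expectedPayoff (g T) (G (T j)) A [] := by
    intro T
    refine expectedPayoff_le_pow_mul (hne _ _) ?_ hρ1 (card_satSet_erase_le_mul ht hm T β j)
      (fun _ _ _ => Nat.cast_nonneg _) A q hA []
    intro u hu
    rw [constantOnTerms, mem_satSet_truncatedTalagrand] at hu
    rw [constantOnTerms, mem_satSet_truncatedTalagrand]
    exact truncatedTalagrandSat_subset (erase_subset _ _) hu
  have hgu : ∀ T τ, g (Function.update T j τ) = g T := by
    intro T τ
    refine truncatedTalagrand_congr fun i hi => ?_
    rw [Function.update_of_ne (ne_of_mem_erase hi)]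
  have hinner : ∀ T, ∑ τ, expectedPayoff (g T) (G τ) A []
      ≤ ((2 * t).choose t : ℝ) * (q * (2 * r + 1)) := by
    intro T
    rw [← expectedPayoff_sum]
    refine expectedPayoff_le_of_le (Q := q) (hne _ _) ?_ A q hA [] (by simp)
    intro h pts a hl
    have := sum_card_disagreement_le (t := t) hq hr (h ++ pts) (by simpa using hl)
    rw [hG]
    simp only
    exact_mod_cast this
  have hcard : (Fintype.card (Term L.m t) : ℝ) = (6 * t).choose t := by rw [card_term, hm]
  have hmain := sum_sum_update j fun T => expectedPayoff (g T) (G (T j)) A []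
  simp only [hgu, Function.update_self, hcard] at hmain
  have h6 : ∑ T, expectedPayoff (g T) (G (T j)) A []
      ≤ Fintype.card (Fin M → Term L.m t)
        * ((2 * t).choose t / (6 * t).choose t * (q * (2 * r + 1))) := by
    have h7 := sum_le_card_nsmul univ (fun T => ∑ τ, expectedPayoff (g T) (G τ) A []) _
      fun T _ => hinner T
    rw [hmain, nsmul_eq_mul, card_univ] at h7
    rw [← mul_le_mul_iff_right₀ h5]
    refine h7.trans_eq ?_
    field_simp
  calc _ ≤ ∑ T, ρ ^ q * expectedPayoff (g T) (G (T j)) A [] := sum_le_sum fun T _ => hstep T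
    _ = ρ ^ q * ∑ T, expectedPayoff (g T) (G (T j)) A [] := by rw [mul_sum]
    _ ≤ ρ ^ q * _ := mul_le_mul_of_nonneg_left h6 (by positivity)
    _ = _ := by ring

open Classical in
/-- The probability that the algorithm sees two points of one term that differ in the
variable of that term is small. -/
theorem sum_bad_le {M q r : ℕ} (ht : 1 ≤ t) (hm : L.m = 6 * t)
    (hq : q ≤ L.m) (hr : L.m * L.m ≤ 2 ^ r) (A : NonadaptiveAlg n) (hA : A.MakesAtMost q) :
    ∑ T : Fin M → Term L.m t, ∑ v : Fin M → Fin L.m, ∑ β : Fin M → Bool,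
      expectedPayoff (constantOnTerms L (2 * t) (fun j => (T j).1) univ β) (fun h pts _ =>
        if ∃ j, v j ∈ disagreement L (2 * t) (T j).1 (h ++ pts) then 1 else 0) A []
      ≤ Fintype.card (Fin M → Term L.m t) * Fintype.card (Fin M → Fin L.m)
          * Fintype.card (Fin M → Bool)
        * (M * ((1 + 4 * ((2 * t).choose t / (6 * t).choose t)) ^ q
          * ((2 * t).choose t / (6 * t).choose t * (q * (2 * r + 1)))) / L.m) := by
  have hm0 : (0 : ℝ) < L.m := by rw [hm]; exact_mod_cast (by omega)
  set c : ℝ := (1 + 4 * ((2 * t).choose t / (6 * t).choose t)) ^ q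
          * ((2 * t).choose t / (6 * t).choose t * (q * (2 * r + 1))) with hc
  have h1 : ∀ (T : Fin M → Term L.m t) (β : Fin M → Bool), ∑ v : Fin M → Fin L.m,
      expectedPayoff (constantOnTerms L (2 * t) (fun j => (T j).1) univ β) (fun h pts _ =>
        if ∃ j, v j ∈ disagreement L (2 * t) (T j).1 (h ++ pts) then 1 else 0) A []
      ≤ ∑ j, (Fintype.card (Fin M → Fin L.m) / L.m) *
        expectedPayoff (constantOnTerms L (2 * t) (fun j => (T j).1) univ β)
        (fun h pts _ => (#(disagreement L (2 * t) (T j).1 (h ++ pts)) : ℝ)) A [] := by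
    intro T β
    rw [← expectedPayoff_sum]
    simp only [← expectedPayoff_mul]
    rw [← expectedPayoff_sum]
    refine expectedPayoff_mono (fun h pts _ => ?_) _ _
    calc _ ≤ ∑ v : Fin M → Fin L.m, ∑ j,
          if v j ∈ disagreement L (2 * t) (T j).1 (h ++ pts) then (1 : ℝ) else 0 := by
          refine sum_le_sum fun v _ => ?_
          split_ifs with hv
          · obtain ⟨j, hj⟩ := hv
            refine le_trans ?_ (single_le_sum (f := fun j =>
              if v j ∈ disagreement L (2 * t) (T j).1 (h ++ pts) then (1 : ℝ) else 0)
              (fun j _ => by split_ifs <;> norm_num) (mem_univ j))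
            simp only [if_pos hj, le_refl]
          · exact sum_nonneg fun j _ => by split_ifs <;> norm_num
      _ = ∑ j, ∑ v : Fin M → Fin L.m,
          if v j ∈ disagreement L (2 * t) (T j).1 (h ++ pts) then (1 : ℝ) else 0 := sum_comm
      _ = _ := by
          refine sum_congr rfl fun j _ => ?_
          have := card_mul_sum_apply j fun a : Fin L.m =>
            if a ∈ disagreement L (2 * t) (T j).1 (h ++ pts) then (1 : ℝ) else 0
          have hcount : ∑ a : Fin L.m,
              (if a ∈ disagreement L (2 * t) (T j).1 (h ++ pts) then (1 : ℝ) else 0)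
              = #(disagreement L (2 * t) (T j).1 (h ++ pts)) := by simp
          rw [hcount] at this
          rw [div_mul_eq_mul_div, eq_div_iff hm0.ne', ← this, Fintype.card_fin, mul_comm]
  calc _ = ∑ β : Fin M → Bool, ∑ T : Fin M → Term L.m t, ∑ v : Fin M → Fin L.m,
      expectedPayoff (constantOnTerms L (2 * t) (fun j => (T j).1) univ β) (fun h pts _ =>
        if ∃ j, v j ∈ disagreement L (2 * t) (T j).1 (h ++ pts) then 1 else 0) A [] := by
        conv_rhs => rw [sum_comm]
        exact sum_congr rfl fun T _ => sum_comm
    _ ≤ ∑ β : Fin M → Bool, ∑ T : Fin M → Term L.m t, ∑ j,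
        (Fintype.card (Fin M → Fin L.m) / L.m) *
        expectedPayoff (constantOnTerms L (2 * t) (fun j => (T j).1) univ β)
        (fun h pts _ => (#(disagreement L (2 * t) (T j).1 (h ++ pts)) : ℝ)) A [] :=
        sum_le_sum fun β _ => sum_le_sum fun T _ => h1 T β
    _ ≤ ∑ β : Fin M → Bool, ∑ j : Fin M, (Fintype.card (Fin M → Fin L.m) / L.m : ℝ) *
        (Fintype.card (Fin M → Term L.m t) * c) := by
        refine sum_le_sum fun β _ => ?_
        rw [sum_comm]
        refine sum_le_sum fun j _ => ?_
        rw [← mul_sum]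
        exact mul_le_mul_of_nonneg_left
          (sum_expectedPayoff_disagreement_le ht hm hq hr A hA β j) (by positivity)
    _ = _ := by
        rw [sum_const, sum_const, card_univ, card_univ, Fintype.card_fin M, nsmul_eq_mul,
          nsmul_eq_mul]
        ring

end leaveOneOut

/-! ### Distance of the literal family from unate functions -/

theorem mem_symmDiff_satSet {n : ℕ} {f g : Cube n → Bool} {u : Cube n} :
    u ∈ symmDiff (satSet f) (satSet g) ↔ f u ≠ g u := by
  simp only [mem_symmDiff, satSet, mem_filter, mem_univ, true_and]
  cases f u <;> cases g u <;> simp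

theorem card_le_two_mul_of_forall_or {α : Type*} [DecidableEq α] {U S : Finset α} {φ : α → α}
    (hφ : Set.InjOn φ U) (h : ∀ u ∈ U, u ∈ S ∨ φ u ∈ S) : #U ≤ 2 * #S := by
  have h1 : U ⊆ U.filter (· ∈ S) ∪ U.filter fun u => φ u ∈ S := fun u hu => by
    rw [mem_union, mem_filter, mem_filter]
    exact (h u hu).imp (⟨hu, ·⟩) (⟨hu, ·⟩)
  have h2 : #(U.filter (· ∈ S)) ≤ #S := card_le_card fun u hu => (mem_filter.1 hu).2
  have h3 : #(U.filter fun u => φ u ∈ S) ≤ #S :=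
    card_le_card_of_injOn φ (fun u hu => (mem_filter.1 hu).2)
      (hφ.mono fun u hu => (mem_filter.1 hu).1)
  have := (card_le_card h1).trans (card_union_le _ _)
  omega

section far

variable {n : ℕ} {L : Layout n} {k : ℕ} {ι : Type*}
  {T : ι → Finset (Fin L.m)} {v : ι → Fin L.m}

theorem choose_le_two_mul_card_filter_notMem {m k : ℕ} (h : 3 * k ≤ m) (hk : 1 ≤ k)
    (i : Fin m) : m.choose k ≤ 2 * #{X : Finset (Fin m) | #X = k ∧ i ∉ X} := by
  have h1 := card_filter_superset m k {i}
  simp only [card_singleton, singleton_subset_iff] at h1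
  have h2 : #{X : Finset (Fin m) | #X = k}
      = #{X : Finset (Fin m) | #X = k ∧ i ∈ X} + #{X : Finset (Fin m) | #X = k ∧ i ∉ X} := by
    rw [← filter_filter, ← filter_filter, card_filter_add_card_filter_not]
  rw [card_filter_card_eq] at h2
  obtain ⟨m, rfl⟩ : ∃ m', m = m' + 1 := ⟨m - 1, by omega⟩
  obtain ⟨k, rfl⟩ : ∃ k', k = k' + 1 := ⟨k - 1, by omega⟩
  have h3 := Nat.choose_le_succ_of_lt_half_left (n := m) (r := k) (by omega)
  rw [Nat.choose_succ_succ'] at h2 ⊢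
  simp only [Nat.add_sub_cancel] at h1
  omega

open Classical in
-- With both flags unset, the truncation makes the function drop from `1` to `0` on every edge in
-- direction `i` from level `k` to `k + 1`, and `g` errs at an endpoint of each. These edges are
-- disjoint, and at least half of level `k` omits `i`.
theorem le_card_symmDiff_of_oneMonotoneIn {pay : ι → Finset (Fin L.m) → Bool} {R : Finset ι}
    (h : 3 * k ≤ L.m) (hk : 1 ≤ k) {g : Cube n → Bool} {i : Fin L.m}
    (hg : OneMonotoneIn g (L.main i)) :
    L.m.choose k * 2 ^ L.b
      ≤ 4 * #(symmDiff (satSet (truncatedTalagrand L k R T pay)) (satSet g)) := by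
  have h1 := Layout.card_filter_alive (L := L) (fun _ => false)
    fun X : Finset (Fin L.m) => #X = k ∧ i ∉ X
  have h2 := Nat.mul_le_mul_right (2 ^ L.b) (choose_le_two_mul_card_filter_notMem h hk i)
  rw [mul_assoc, ← h1] at h2
  refine h2.trans ?_
  rw [show 4 = 2 * 2 from rfl, mul_assoc]
  refine Nat.mul_le_mul_left _
    (card_le_two_mul_of_forall_or (φ := fun u => Function.update u (L.main i) true) ?_ ?_)
  · intro u hu w hw huw
    simp only [coe_filter, mem_univ, true_and, Set.mem_ofPred_eq, Layout.mem_ones,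
      Bool.not_eq_true] at hu hw
    ext x
    by_cases hx : x = L.main i
    · rw [hx, hu.2.2.2, hw.2.2.2]
    · simpa [hx] using congrFun huw x
  · intro u hu
    simp only [mem_filter, mem_univ, true_and] at hu
    obtain ⟨hu1, hu2, hu3, hu4⟩ := hu
    rw [mem_symmDiff_satSet, mem_symmDiff_satSet]
    have hf1 : truncatedTalagrand L k R T pay u = true :=
      truncatedTalagrand_eq_true.2 ⟨hu1, hu3.le, ⟨true, hu2 _⟩, Or.inl hu2⟩
    have hf2 : truncatedTalagrand L k R T pay (Function.update u (L.main i) true) = false := by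
      rw [← Bool.not_eq_true, truncatedTalagrand_eq_true]
      rintro ⟨-, h', -⟩
      rw [Layout.ones_update_main, if_pos rfl, card_insert_of_notMem hu4] at h'
      omega
    have hg' := hg u
    rw [show Function.update u (L.main i) false = u by
      rw [Layout.mem_ones, Bool.not_eq_true] at hu4
      rw [← hu4, Function.update_eq_self]] at hg'
    rw [hf1, hf2]
    revert hg'
    cases g u <;> cases g (Function.update u (L.main i) true) <;> simp

variable [Fintype ι]

/-- Both `X` and `insert (v j) X` satisfy the term `j` and no other term, and `v j ∉ X`. -/
def IsCriticalFor (L : Layout n) (T : ι → Finset (Fin L.m)) (v : ι → Fin L.m)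
    (X : Finset (Fin L.m)) (j : ι) : Prop :=
  T j ⊆ X ∧ v j ∉ X ∧ ∀ j', j' ≠ j → ¬ T j' ⊆ insert (v j) X

theorem IsCriticalFor.satisfied_insert {X : Finset (Fin L.m)} {j : ι}
    (h : IsCriticalFor L T v X j) : satisfied L univ T (insert (v j) X) = {j} := by
  ext i
  simp only [satisfied, mem_filter, mem_univ, true_and, mem_singleton]
  refine ⟨fun hi => by_contra fun hij => h.2.2 i hij hi, ?_⟩
  rintro rfl
  exact h.1.trans (subset_insert _ _)

theorem IsCriticalFor.satisfied {X : Finset (Fin L.m)} {j : ι}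
    (h : IsCriticalFor L T v X j) : satisfied L univ T X = {j} := by
  ext i
  simp only [RelativeError.satisfied, mem_filter, mem_univ, true_and, mem_singleton]
  refine ⟨fun hi => by_contra fun hij => h.2.2 i hij (hi.trans (subset_insert _ _)), ?_⟩
  rintro rfl
  exact h.1

theorem IsCriticalFor.eq {X : Finset (Fin L.m)} {j j' : ι}
    (h : IsCriticalFor L T v X j) (h' : IsCriticalFor L T v X j') : j = j' :=
  singleton_injective (h.satisfied.symm.trans h'.satisfied)

open Classical in
/-- The sets of size `k - 1` that are critical for some term. -/
noncomputable def criticalSets (L : Layout n) (k : ℕ) (T : ι → Finset (Fin L.m))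
    (v : ι → Fin L.m) : Finset (Finset (Fin L.m)) :=
  {X | #X + 1 = k ∧ ∃ j, IsCriticalFor L T v X j}

theorem card_add_one_of_mem_criticalSets {X : Finset (Fin L.m)} (hX : X ∈ criticalSets L k T v) :
    #X + 1 = k := by
  classical exact (mem_filter.1 hX).2.1

open Classical in
-- If the second flag equals `β j` and the other flag is its negation, the function increases from a
-- critical `X` to `insert (v j) X`, so `g` errs at an endpoint.
theorem card_criticalSets_mul_le {β : ι → Bool} {g : Cube n → Bool} (hg : ∀ i, ZeroMonotoneIn g (L.main i)) :
    #(criticalSets L k T v) * 2 ^ L.b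
      ≤ 4 * #(symmDiff (satSet (literalOnTerms L k T v β)) (satSet g)) := by
  set P : (Bool → Bool) → Finset (Fin L.m) → Prop := fun c X =>
    X ∈ criticalSets L k T v ∧ ∃ j, IsCriticalFor L T v X j ∧ β j = c true with hP
  have key : ∀ c : Bool → Bool, c false = !c true → #{X | P c X} * 2 ^ L.b
      ≤ 2 * #(symmDiff (satSet (literalOnTerms L k T v β)) (satSet g)) := by
    intro c hc
    rw [← Layout.card_filter_alive c (P c)]
    set φ : Cube n → Cube n := fun u =>
      if h : ∃ j, IsCriticalFor L T v (L.ones u) j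
        then Function.update u (L.main (v h.choose)) true else u with hφ
    have hφj : ∀ u j, IsCriticalFor L T v (L.ones u) j →
        φ u = Function.update u (L.main (v j)) true := by
      intro u j hj
      have hex : ∃ j, IsCriticalFor L T v (L.ones u) j := ⟨j, hj⟩
      rw [hφ]
      simp only [dif_pos hex]
      rw [hex.choose_spec.eq hj]
    -- The upper endpoint determines the edge: `j` is its only satisfied term, and the lower
    -- endpoint is recovered by resetting `v j`.
    refine card_le_two_mul_of_forall_or (φ := φ) ?_ ?_
    · intro u hu w hw huw
      simp only [coe_filter, mem_univ, true_and, Set.mem_ofPred_eq, hP] at hu hw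
      obtain ⟨-, -, -, j, hj, -⟩ := hu
      obtain ⟨-, -, -, j', hj', -⟩ := hw
      rw [hφj u j hj, hφj w j' hj'] at huw
      have h1 := hj.satisfied_insert
      have h2 := hj'.satisfied_insert
      have h3 := congrArg L.ones huw
      rw [Layout.ones_update_main, Layout.ones_update_main, if_pos rfl, if_pos rfl] at h3
      rw [h3, h2] at h1
      obtain rfl := singleton_injective h1
      ext x
      by_cases hx : x = L.main (v j')
      · have h4 := hj.2.1
        have h5 := hj'.2.1
        rw [Layout.mem_ones, Bool.not_eq_true] at h4 h5
        rw [hx, h4, h5]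
      · simpa [hx] using congrFun huw x
    · intro u hu
      simp only [mem_filter, mem_univ, true_and, hP] at hu
      obtain ⟨hu1, hu2, hu3, j, hj, hβ⟩ := hu
      have hcard := card_add_one_of_mem_criticalSets hu3
      rw [hφj u j hj, mem_symmDiff_satSet, mem_symmDiff_satSet]
      have hf1 : literalOnTerms L k T v β u = false := by
        rw [← Bool.not_eq_true, literalOnTerms, truncatedTalagrand_eq_true]
        rintro ⟨-, -, -, h' | h' | h' | ⟨j', h', h''⟩⟩
        · have h1 := h' true
          have h2 := h' false
          rw [hu2] at h1 h2
          rw [hc, h1] at h2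
          simp at h2
        · omega
        · rw [hj.satisfied] at h'
          simp at h'
        · rw [hj.satisfied] at h'
          obtain rfl := singleton_injective h'
          simp [hj.2.1, hβ, hu2] at h''
      have hf2 : literalOnTerms L k T v β (Function.update u (L.main (v j)) true) = true := by
        rw [literalOnTerms, truncatedTalagrand_eq_true, truncatedTalagrandSat]
        simp only [Layout.alive_update_main, Layout.update_main_flagPos,
          Layout.ones_update_main, if_true]
        refine ⟨hu1, (card_insert_le _ _).trans hcard.le, ?_,
          Or.inr (Or.inr (Or.inr ⟨j, hj.satisfied_insert, ?_⟩))⟩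
        · cases h1 : c true
          · exact ⟨true, by rw [hu2, h1]⟩
          · exact ⟨false, by rw [hu2, hc, h1]; rfl⟩
        · simp [hβ, hu2]
      have hg' := hg (v j) u
      rw [show Function.update u (L.main (v j)) false = u by
        have h1 := hj.2.1
        rw [Layout.mem_ones, Bool.not_eq_true] at h1
        rw [← h1, Function.update_eq_self]] at hg'
      rw [hf1, hf2]
      revert hg'
      cases g u <;> cases g (Function.update u (L.main (v j)) true) <;> simp
  have h1 := key id rfl
  have h2 := key not rfl
  have h3 : #(criticalSets L k T v) ≤ #{X | P id X} + #{X | P not X} := by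
    refine le_trans (card_le_card fun X hX => ?_) (card_union_le _ _)
    obtain ⟨j, hj⟩ := (mem_filter.1 hX).2.2
    rw [mem_union, mem_filter, mem_filter]
    cases hb : β j
    · exact Or.inr ⟨mem_univ _, hX, j, hj, by simp [hb]⟩
    · exact Or.inl ⟨mem_univ _, hX, j, hj, by simp [hb]⟩
  have h4 := Nat.mul_le_mul_right (2 ^ L.b) h3
  rw [add_mul] at h4
  omega

theorem unate_nonempty (n : ℕ) : (unate n).Nonempty :=
  ⟨fun _ => false, fun _ => Or.inl fun _ => le_rfl⟩

/-- If many sets are critical, `literalOnTerms` is far from unate. -/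
theorem le_relDistTo_unate (h : 3 * k ≤ L.m) (hk : 1 ≤ k) (β : ι → Bool)
    (hV : L.m.choose k ≤ 144 * #(criticalSets L k T v)) :
    1 / 3456 ≤ relDistTo (literalOnTerms L k T v β) (unate n) := by
  refine le_csInf ((unate_nonempty n).image _) ?_
  rintro _ ⟨g, hg, rfl⟩
  have hW : 0 < L.m.choose k * 2 ^ L.b :=
    Nat.mul_pos (Nat.choose_pos (by omega)) (by positivity)
  have h1 := choose_mul_le_card_satSet (L := L) (k := k) (R := univ) (T := T)
    (pay := fun j X => xor (β j) (decide (v j ∈ X)))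
  have h2 := card_satSet_le (L := L) (R := univ) (T := T)
    (pay := fun j X => xor (β j) (decide (v j ∈ X))) h
  rw [relDist, le_div_iff₀ (by exact_mod_cast hW.trans_le h1)]
  -- `576 = 4 * 144`, and `3456 = 6 * 576` after the upper bound on the size of `f⁻¹(1)`.
  have h3 : L.m.choose k * 2 ^ L.b
      ≤ 576 * #(symmDiff (satSet (literalOnTerms L k T v β)) (satSet g)) := by
    by_cases hi : ∃ i, OneMonotoneIn g (L.main i)
    · obtain ⟨i, hi⟩ := hi
      have := le_card_symmDiff_of_oneMonotoneIn (R := univ) (T := T)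
        (pay := fun j X => xor (β j) (decide (v j ∈ X))) h hk hi
      rw [literalOnTerms]
      convert this.trans (Nat.mul_le_mul_right _ (show 4 ≤ 576 by norm_num)) using 4
    · have := card_criticalSets_mul_le (L := L) (k := k) (T := T) (v := v) (β := β)
        (fun i => (hg (L.main i)).resolve_left fun h => hi ⟨i, h⟩)
      have h4 := Nat.mul_le_mul_right (2 ^ L.b) hV
      rw [mul_assoc] at h4
      refine (h4.trans (Nat.mul_le_mul_left _ this)).trans_eq ?_
      rw [← mul_assoc]
      norm_num
  have h4 := h2.trans (Nat.mul_le_mul_left 6 h3)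
  have h5 : ((_ : ℕ) : ℝ) ≤ ((_ : ℕ) : ℝ) := Nat.cast_le.2 h4
  push_cast at h5
  rw [literalOnTerms] at h5 ⊢
  linarith

end far

/-! ### The number of terms and the probability of satisfying one -/

theorem one_sub_pow_ge {M : ℕ} {p : ℝ} (hM : 1 ≤ M) (hp : p ≤ 1 / 2)
    (hMp : M * p ≤ 1) : 1 / 3 ≤ (1 - p) ^ (M - 1) := by
  have h1 : 0 < 1 - p := by linarith
  have h2 : (1 - p)⁻¹ ≤ Real.exp (p / (1 - p)) := by
    have := Real.add_one_le_exp (p / (1 - p))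
    refine le_trans (le_of_eq ?_) this
    field_simp
    ring
  have h3 : ((1 - p) ^ (M - 1))⁻¹ ≤ 3 := by
    rw [← inv_pow]
    calc _ ≤ Real.exp (p / (1 - p)) ^ (M - 1) := by gcongr
      _ = Real.exp ((M - 1 : ℕ) * (p / (1 - p))) := (Real.exp_nat_mul _ _).symm
      _ ≤ Real.exp 1 := by
        rw [Real.exp_le_exp, mul_div_assoc', div_le_one h1, Nat.cast_sub hM]
        push_cast
        linarith
      _ ≤ 3 := Real.exp_one_lt_three.le
  have h4 : 0 < (1 - p) ^ (M - 1) := by positivity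
  rw [inv_le_comm₀ h4 (by norm_num)] at h3
  linarith

theorem three_pow_mul_choose_le (t : ℕ) : 3 ^ t * (2 * t).choose t ≤ (6 * t).choose t := by
  have key : ∀ s, s ≤ 2 * t → 3 ^ s * (2 * t).descFactorial s ≤ (6 * t).descFactorial s := by
    intro s
    induction s with
    | zero => simp
    | succ s ih =>
      intro hs
      have h1 := ih (by omega)
      rw [Nat.descFactorial_succ, Nat.descFactorial_succ]
      calc 3 ^ (s + 1) * ((2 * t - s) * (2 * t).descFactorial s)
          = (3 * (2 * t - s)) * (3 ^ s * (2 * t).descFactorial s) := by ring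
        _ ≤ _ := Nat.mul_le_mul (by omega) h1
  have h := key t (by omega)
  rw [Nat.descFactorial_eq_factorial_mul_choose, Nat.descFactorial_eq_factorial_mul_choose] at h
  have hpos := Nat.factorial_pos t
  refine Nat.le_of_mul_le_mul_left ?_ hpos
  calc _ = 3 ^ t * (t.factorial * (2 * t).choose t) := by ring
    _ ≤ _ := h

/-- The number of terms. -/
def numTerms (t : ℕ) : ℕ := (6 * t).choose t / (2 * t).choose t

/-- The probability that a random term is satisfied by a given set of size `2 * t`. -/
noncomputable def termProb (t : ℕ) : ℝ := (2 * t).choose t / (6 * t).choose t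

theorem termProb_nonneg (t : ℕ) : 0 ≤ termProb t := by unfold termProb; positivity

theorem termProb_le (t : ℕ) : termProb t ≤ 1 / 3 ^ t := by
  have h : (0 : ℝ) < (6 * t).choose t := by exact_mod_cast Nat.choose_pos (by omega)
  rw [termProb, div_le_div_iff₀ h (by positivity), one_mul, mul_comm]
  exact_mod_cast three_pow_mul_choose_le t

theorem numTerms_mul_termProb_le (t : ℕ) : numTerms t * termProb t ≤ 1 := by
  have h : (0 : ℝ) < (6 * t).choose t := by exact_mod_cast Nat.choose_pos (by omega)
  rw [termProb, mul_div_assoc', div_le_one h]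
  exact_mod_cast Nat.div_mul_le_self _ _

theorem termProb_le_half {t : ℕ} (ht : 1 ≤ t) : termProb t ≤ 1 / 2 := by
  refine (termProb_le t).trans ?_
  have : (3 : ℝ) ^ 1 ≤ 3 ^ t := pow_le_pow_right₀ (by norm_num) ht
  rw [div_le_div_iff₀ (by positivity) (by norm_num)]
  linarith

theorem half_le_numTerms_mul_termProb {t : ℕ} (ht : 1 ≤ t) :
    1 / 2 ≤ numTerms t * termProb t := by
  have h : (0 : ℝ) < (6 * t).choose t := by exact_mod_cast Nat.choose_pos (by omega)
  have h1 : (6 * t).choose t < (numTerms t + 1) * (2 * t).choose t := by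
    have := Nat.lt_div_mul_add (a := (6 * t).choose t) (b := (2 * t).choose t)
      (Nat.choose_pos (by omega))
    rw [add_mul, one_mul]
    exact this
  have h2 : ((6 * t).choose t : ℝ) ≤ (numTerms t + 1) * (2 * t).choose t := by
    exact_mod_cast h1.le
  have h3 : 1 ≤ (numTerms t + 1) * termProb t := by
    rw [termProb, mul_div_assoc', le_div_iff₀ h, one_mul]
    exact h2
  linarith [termProb_le_half ht]

theorem one_le_numTerms {t : ℕ} (ht : 1 ≤ t) : 1 ≤ numTerms t := by
  have h := half_le_numTerms_mul_termProb ht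
  rw [Nat.one_le_iff_ne_zero]
  intro h0
  rw [h0] at h
  norm_num at h

theorem two_mul_choose_sub_one {t : ℕ} (ht : 1 ≤ t) :
    2 * (2 * t - 1).choose t = (2 * t).choose t := by
  obtain ⟨s, rfl⟩ : ∃ s, t = s + 1 := ⟨t - 1, by omega⟩
  rw [show 2 * (s + 1) = 2 * s + 1 + 1 by ring, Nat.choose_succ_succ',
    Nat.choose_symm_half, Nat.add_sub_cancel]
  have := Nat.choose_symm_half s
  omega

/-! ### Many sets are critical -/

section expectedCritical

variable {n : ℕ} {L : Layout n} {t : ℕ}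

open Classical in
-- For fixed `X` and `v`, criticality is one independent condition per term: `T j` lies in a set of
-- size `2t - 1`, and every other term avoids lying in a set of size `2t`.
theorem card_filter_isCriticalFor {M : ℕ} (X : Finset (Fin L.m)) (hX : #X + 1 = 2 * t)
    (v : Fin M → Fin L.m) (j : Fin M) (hv : v j ∉ X) :
    #{T : Fin M → Term L.m t | IsCriticalFor L (fun j => (T j).1) v X j}
      = (2 * t - 1).choose t * (L.m.choose t - (2 * t).choose t) ^ (M - 1) := by
  set A : Fin M → Finset (Term L.m t) := fun i =>
    if i = j then ({τ : Term L.m t | τ.1 ⊆ X} : Finset _)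
      else ({τ : Term L.m t | ¬ τ.1 ⊆ insert (v j) X} : Finset _) with hA
  have h1 : ({T : Fin M → Term L.m t | IsCriticalFor L (fun j => (T j).1) v X j} : Finset _)
      = Fintype.piFinset A := by
    ext T
    simp only [mem_filter, mem_univ, true_and, Fintype.mem_piFinset, IsCriticalFor, hv,
      not_false_eq_true, hA]
    constructor
    · rintro ⟨h1, h2⟩ i
      by_cases hi : i = j
      · rw [if_pos hi, mem_filter, hi]
        exact ⟨mem_univ _, h1⟩
      · rw [if_neg hi, mem_filter]
        exact ⟨mem_univ _, h2 i hi⟩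
    · intro h
      refine ⟨?_, fun i hi => ?_⟩
      · simpa using h j
      · simpa [hi] using h i
  have h2 : #(A j) = (2 * t - 1).choose t := by
    rw [hA]
    simp only [if_true]
    rw [card_filter_term_subset, show #X = 2 * t - 1 by omega]
  have h3 : ∀ i, i ≠ j → #(A i) = L.m.choose t - (2 * t).choose t := by
    intro i hi
    rw [hA]
    simp only [if_neg hi]
    rw [filter_not, ← compl_eq_univ_sdiff, card_compl, card_filter_term_subset, card_term,
      card_insert_of_notMem hv, hX]
  rw [h1, Fintype.card_piFinset, ← mul_prod_erase _ _ (mem_univ j), h2,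
    prod_congr rfl fun i hi => h3 i (ne_of_mem_erase hi), prod_const,
    card_erase_of_mem (mem_univ j), card_univ, Fintype.card_fin]

theorem card_criticalSets_eq {ι : Type*} [Fintype ι] (k : ℕ) (T : ι → Finset (Fin L.m))
    (v : ι → Fin L.m) [∀ X j, Decidable (IsCriticalFor L T v X j)] :
    #(criticalSets L k T v)
      = ∑ X : Finset (Fin L.m) with #X + 1 = k, ∑ j, if IsCriticalFor L T v X j then 1 else 0 := by
  classical
  rw [criticalSets, ← filter_filter, card_filter]
  refine sum_congr rfl fun X _ => ?_
  split_ifs with h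
  · obtain ⟨j, hj⟩ := h
    rw [sum_eq_single j (fun i _ hi => if_neg fun h => hi (h.eq hj))
      (fun h => absurd (mem_univ _) h), if_pos hj]
  · exact (sum_eq_zero fun j _ => if_neg fun hj => h ⟨j, hj⟩).symm

/-- The constant is a product: level `2t - 1` has at least `2/5` of the size of level `2t`, `M p ≥
1/2`, `T j ⊆ X` has probability `p / 2`, the other terms stay out with probability at least `1/3`,
and `v j ∉ X` has probability at least `2/3`. -/
theorem choose_mul_le_sum_card_criticalSets (ht : 1 ≤ t) (hm : L.m = 6 * t) :
    (Fintype.card (Fin (numTerms t) → Term L.m t) : ℝ)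
        * Fintype.card (Fin (numTerms t) → Fin L.m) * (6 * t).choose (2 * t) / 45
      ≤ ∑ T : Fin (numTerms t) → Term L.m t, ∑ v : Fin (numTerms t) → Fin L.m,
          (#(criticalSets L (2 * t) (fun j => (T j).1) v) : ℝ) := by
  classical
  set M := numTerms t with hMdef
  have hM := one_le_numTerms ht
  rw [← hMdef] at hM
  set p := termProb t with hp
  have hN : (0 : ℝ) < (6 * t).choose t := by exact_mod_cast Nat.choose_pos (by omega)
  set E : ℝ := (Fintype.card (Fin M → Term L.m t) : ℝ) with hE
  have hE0 : 0 < E := by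
    rw [hE, Fintype.card_fun, card_term, Fintype.card_fin, hm]
    push_cast
    positivity
  have hm0 : (0 : ℝ) < L.m := by rw [hm]; exact_mod_cast (by omega)
  have hterm : E * (p / 2) * (1 / 3)
      ≤ ((2 * t - 1).choose t * (L.m.choose t - (2 * t).choose t) ^ (M - 1) : ℕ) := by
    have h1 : ((2 * t - 1).choose t : ℝ) = (6 * t).choose t * (p / 2) := by
      rw [hp, termProb, ← two_mul_choose_sub_one ht]
      push_cast
      field_simp
    have h2 : ((L.m.choose t - (2 * t).choose t : ℕ) : ℝ) = (6 * t).choose t * (1 - p) := by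
      rw [hm, Nat.cast_sub (Nat.choose_le_choose _ (by omega)), hp, termProb]
      field_simp
    have h3 : E = ((6 * t).choose t : ℝ) * (6 * t).choose t ^ (M - 1) := by
      rw [hE, Fintype.card_fun, card_term, Fintype.card_fin, hm, ← pow_succ',
        Nat.sub_add_cancel hM]
      push_cast
      rfl
    rw [Nat.cast_mul, Nat.cast_pow, h1, h2, h3, mul_pow]
    have h4 := one_sub_pow_ge hM (termProb_le_half ht)
      (numTerms_mul_termProb_le t)
    rw [← hp] at h4
    have hp0 : 0 ≤ p := termProb_nonneg t
    calc _ = ((6 * t).choose t : ℝ) * (p / 2) * (6 * t).choose t ^ (M - 1) * (1 / 3) := by ring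
      _ ≤ ((6 * t).choose t : ℝ) * (p / 2) * (6 * t).choose t ^ (M - 1) * (1 - p) ^ (M - 1) := by
          gcongr
      _ = _ := by ring
  have hv : ∀ X : Finset (Fin L.m), #X + 1 = 2 * t → ∀ j : Fin M,
      (Fintype.card (Fin M → Fin L.m) : ℝ) * (2 / 3)
        ≤ ∑ v : Fin M → Fin L.m, if v j ∉ X then (1 : ℝ) else 0 := by
    intro X hX j
    have h1 := card_mul_sum_apply j fun a : Fin L.m => if a ∉ X then (1 : ℝ) else 0
    have h2 : ∑ a : Fin L.m, (if a ∉ X then (1 : ℝ) else 0) = L.m - #X := by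
      rw [sum_boole, filter_not, ← compl_eq_univ_sdiff, filter_mem_eq_inter, univ_inter,
        card_compl, Fintype.card_fin, Nat.cast_sub (by simpa using card_le_univ X)]
    rw [h2, Fintype.card_fin] at h1
    rw [← mul_le_mul_iff_right₀ hm0, h1]
    have h3 : (#X : ℝ) + 1 = 2 * t := by exact_mod_cast hX
    have h4 : (L.m : ℝ) = 6 * t := by exact_mod_cast hm
    have h5 : (L.m : ℝ) * (2 / 3) ≤ L.m - #X := by rw [h4]; linarith
    calc _ = (Fintype.card (Fin M → Fin L.m) : ℝ) * (L.m * (2 / 3)) := by ring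
      _ ≤ _ := mul_le_mul_of_nonneg_left h5 (Nat.cast_nonneg _)
  have hXj : ∀ X : Finset (Fin L.m), #X + 1 = 2 * t → ∀ j : Fin M,
      E * (p / 2) * (1 / 3) * (Fintype.card (Fin M → Fin L.m) * (2 / 3))
        ≤ ∑ v : Fin M → Fin L.m, ∑ T : Fin M → Term L.m t,
          if IsCriticalFor L (fun j => (T j).1) v X j then (1 : ℝ) else 0 := by
    intro X hX j
    refine (mul_le_mul_of_nonneg_left (hv X hX j) (by
      have := termProb_nonneg t; positivity)).trans ?_
    rw [mul_sum]
    refine sum_le_sum fun v _ => ?_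
    by_cases hvX : v j ∉ X
    · rw [if_pos hvX, sum_boole, card_filter_isCriticalFor X hX v j hvX, mul_one]
      exact hterm
    · rw [if_neg hvX, mul_zero]
      exact sum_nonneg fun T _ => by split_ifs <;> norm_num
  have hlayer : ((6 * t).choose (2 * t) : ℝ) * (2 / 5)
      ≤ #{X : Finset (Fin L.m) | #X + 1 = 2 * t} := by
    have h1 : ({X : Finset (Fin L.m) | #X + 1 = 2 * t} : Finset _)
        = ({X : Finset (Fin L.m) | #X = 2 * t - 1} : Finset _) := by
      ext X
      simp only [mem_filter, mem_univ, true_and]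
      omega
    rw [h1, card_filter_card_eq, hm]
    have h2 := Nat.choose_succ_right_eq (6 * t) (2 * t - 1)
    rw [show 2 * t - 1 + 1 = 2 * t by omega, show 6 * t - (2 * t - 1) = 4 * t + 1 by omega] at h2
    have h3 : ((6 * t).choose (2 * t) : ℝ) * (2 * t)
        = (6 * t).choose (2 * t - 1) * (4 * t + 1) := by exact_mod_cast h2
    have ht' : (1 : ℝ) ≤ t := by exact_mod_cast ht
    have h4 : ((6 * t).choose (2 * t - 1) : ℝ) * (4 * t + 1)
        ≤ (6 * t).choose (2 * t - 1) * (5 * t) := by gcongr; linarith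
    rw [← h3] at h4
    have h5 : (0 : ℝ) < t := by linarith
    refine le_of_mul_le_mul_right ?_ h5
    linarith
  calc _ ≤ ((6 * t).choose (2 * t) * (2 / 5)) * (M * (E * (p / 2) * (1 / 3)
          * (Fintype.card (Fin M → Fin L.m) * (2 / 3)))) := by
        have h1 := half_le_numTerms_mul_termProb ht
        rw [← hMdef, ← hp] at h1
        calc _ = (E * Fintype.card (Fin M → Fin L.m) * (6 * t).choose (2 * t)) * (2 / 45)
              * (1 / 2) := by ring
          _ ≤ (E * Fintype.card (Fin M → Fin L.m) * (6 * t).choose (2 * t)) * (2 / 45)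
              * (M * p) := by gcongr
          _ = _ := by ring
    _ ≤ #{X : Finset (Fin L.m) | #X + 1 = 2 * t} * (M * (E * (p / 2) * (1 / 3)
          * (Fintype.card (Fin M → Fin L.m) * (2 / 3)))) :=
        mul_le_mul_of_nonneg_right hlayer (by have := termProb_nonneg t; positivity)
    _ ≤ ∑ X : Finset (Fin L.m) with #X + 1 = 2 * t, ∑ j : Fin M,
        ∑ v : Fin M → Fin L.m, ∑ T : Fin M → Term L.m t,
          if IsCriticalFor L (fun j => (T j).1) v X j then (1 : ℝ) else 0 := by
        rw [← nsmul_eq_mul]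
        refine card_nsmul_le_sum _ _ _ fun X hX => ?_
        have := card_nsmul_le_sum univ _ _ fun j _ => hXj X (mem_filter.1 hX).2 j
        rwa [card_univ, Fintype.card_fin, nsmul_eq_mul] at this
    _ = _ := by
        simp_rw [card_criticalSets_eq]
        push_cast
        rw [sum_congr rfl fun (T : Fin M → Term L.m t) _ =>
          sum_comm.trans (sum_congr rfl fun X _ => sum_comm)]
        conv_rhs => rw [sum_comm]
        refine sum_congr rfl fun X _ => ?_
        conv_rhs => rw [sum_comm]
        exact sum_congr rfl fun j _ => sum_comm

/-- With probability at least `1 / 36` there are many critical sets. -/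
theorem card_le_card_filter_criticalSets (ht : 1 ≤ t) (hm : L.m = 6 * t) :
    (Fintype.card ((Fin (numTerms t) → Term L.m t) × (Fin (numTerms t) → Fin L.m)) : ℝ) / 36
      ≤ #{p : (Fin (numTerms t) → Term L.m t) × (Fin (numTerms t) → Fin L.m) |
          L.m.choose (2 * t) ≤ 144 * #(criticalSets L (2 * t) (fun j => (p.1 j).1) p.2)} := by
  set I := (Fin (numTerms t) → Term L.m t) × (Fin (numTerms t) → Fin L.m)
  set V : I → ℕ := fun p => #(criticalSets L (2 * t) (fun j => (p.1 j).1) p.2) with hV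
  set W : ℝ := ((6 * t).choose (2 * t) : ℝ) with hW
  have hW0 : 0 < W := by rw [hW]; exact_mod_cast Nat.choose_pos (by omega)
  have h1 : (Fintype.card I : ℝ) * W / 45 ≤ ∑ p : I, (V p : ℝ) := by
    have := choose_mul_le_sum_card_criticalSets ht hm
    rw [Fintype.sum_prod_type, Fintype.card_prod]
    push_cast
    exact this
  have h2 : ∀ p, (V p : ℝ) ≤ W / 2 := by
    intro p
    have h3 : V p ≤ (6 * t).choose (2 * t - 1) := by
      rw [← card_filter_card_eq, ← hm]
      refine card_le_card fun X hX => ?_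
      have := card_add_one_of_mem_criticalSets hX
      rw [mem_filter]
      exact ⟨mem_univ _, by omega⟩
    have h4 := two_mul_choose_le (m := 6 * t) (k := 2 * t - 1) (by omega)
    rw [show 2 * t - 1 + 1 = 2 * t by omega] at h4
    have h5 : 2 * V p ≤ (6 * t).choose (2 * t) := by omega
    have h6 : 2 * (V p : ℝ) ≤ W := by rw [hW]; exact_mod_cast h5
    linarith
  set s : Finset I := {p | L.m.choose (2 * t) ≤ 144 * V p} with hs
  -- Reverse Markov: `V` is at most `W / 2` always and at most `W / 144` off `s`, while its mean is
  -- at least `W / 45`; and `2 * (1/45 - 1/144) ≥ 1/36`.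
  have h3 : ∑ p : I, (V p : ℝ) ≤ #s * (W / 2) + Fintype.card I * (W / 144) := by
    rw [← sum_filter_add_sum_filter_not univ (fun p => L.m.choose (2 * t) ≤ 144 * V p)]
    refine add_le_add ?_ ?_
    · rw [← nsmul_eq_mul]
      exact sum_le_card_nsmul _ _ _ fun p _ => h2 p
    · calc _ ≤ (#{p : I | ¬ L.m.choose (2 * t) ≤ 144 * V p} : ℝ) * (W / 144) := by
            rw [← nsmul_eq_mul]
            refine sum_le_card_nsmul _ _ _ fun p hp => ?_
            have h4 := (mem_filter.1 hp).2
            rw [hm, not_le] at h4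
            have h5 : 144 * (V p : ℝ) ≤ W := by rw [hW]; exact_mod_cast h4.le
            linarith
        _ ≤ _ := by
            gcongr
            exact_mod_cast card_le_univ _
  have h4 : (Fintype.card I : ℝ) / 45 * W ≤ (#s / 2 + Fintype.card I / 144) * W := by linarith
  have h5 := le_of_mul_le_mul_right h4 hW0
  have h6 : (0 : ℝ) ≤ Fintype.card I := Nat.cast_nonneg _
  linarith

end expectedCritical

/-! ### Combining the bounds and choosing the parameters -/

theorem one_add_four_mul_termProb_pow_le {t q : ℕ} (ht : 5 ≤ t) (hq : q ≤ 6 * t) :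
    (1 + 4 * termProb t) ^ q ≤ 3 := by
  have h0 := termProb_nonneg t
  have h1 : 24 * t ≤ 3 ^ t := by
    induction t, ht using Nat.le_induction generalizing q with
    | base => norm_num
    | succ t ht ih =>
      have := ih (q := 0) (by omega) (termProb_nonneg t)
      rw [pow_succ]
      omega
  have h2 : (24 * t : ℝ) ≤ 3 ^ t := by exact_mod_cast h1
  have h3 : (q : ℝ) ≤ 6 * t := by exact_mod_cast hq
  have h4 : termProb t * 3 ^ t ≤ 1 := by
    have := termProb_le t
    rwa [le_div_iff₀ (by positivity)] at this
  calc (1 + 4 * termProb t) ^ q ≤ Real.exp (4 * termProb t) ^ q := by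
        gcongr
        rw [add_comm]
        exact Real.add_one_le_exp _
    _ = Real.exp (q * (4 * termProb t)) := (Real.exp_nat_mul _ _).symm
    _ ≤ Real.exp 1 := by
        rw [Real.exp_le_exp]
        calc (q : ℝ) * (4 * termProb t) ≤ 6 * t * (4 * termProb t) := by gcongr
          _ = termProb t * (24 * t) := by ring
          _ ≤ termProb t * 3 ^ t := by gcongr
          _ ≤ 1 := h4
    _ ≤ 3 := Real.exp_one_lt_three.le

/-- A tester for functions with about `(6 * t).choose (2 * t) * 2 ^ L.b` satisfying assignments
makes almost linearly many queries in `t`. -/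
theorem le_mul_queries {n : ℕ} (L : Layout n) {t q r : ℕ} (ht : 5 ≤ t) (hm : L.m = 6 * t)
    (hq : q ≤ 6 * t) (hr : (6 * t) * (6 * t) ≤ 2 ^ r) {𝓓 : Set (Cube n → Bool)}
    (h𝓓 : ∀ f : Cube n → Bool, (6 * t).choose (2 * t) * 2 ^ L.b ≤ #(satSet f) →
      #(satSet f) ≤ 6 * ((6 * t).choose (2 * t) * 2 ^ L.b) → f ∈ 𝓓)
    (T : RandomizedAlg n) (hT : IsTesterUnderPromise T (1 / 3456) (unate n) 𝓓)
    (hTq : T.MakesAtMost q) : (6 * t : ℝ) ≤ 324 * q * (2 * r + 1) := by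
  classical
  set M := numTerms t with hM
  set J := (Fin M → Term L.m t) × (Fin M → Fin L.m)
  have hJ : Fintype.card J = Fintype.card (Fin M → Term L.m t) * Fintype.card (Fin M → Fin L.m) :=
    Fintype.card_prod _ _
  have hfam : ∀ (S : Fin M → Finset (Fin L.m)) pay,
      (6 * t).choose (2 * t) * 2 ^ L.b ≤ #(satSet (truncatedTalagrand L (2 * t) univ S pay)) ∧
      #(satSet (truncatedTalagrand L (2 * t) univ S pay))
        ≤ 6 * ((6 * t).choose (2 * t) * 2 ^ L.b) := by
    intro S pay
    have h1 := choose_mul_le_card_satSet (k := 2 * t) (R := univ) (T := S) (pay := pay)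
    have h2 := card_satSet_le (k := 2 * t) (R := univ) (T := S) (pay := pay) (by omega)
    rw [show L.m.choose (2 * t) = (6 * t).choose (2 * t) by rw [hm]] at h1 h2
    exact ⟨h1, h2⟩
  have hne : ∀ (S : Fin M → Finset (Fin L.m)) pay,
      (satSet (truncatedTalagrand L (2 * t) univ S pay)).Nonempty := fun S pay =>
    card_pos.1 (lt_of_lt_of_le
      (Nat.mul_pos (Nat.choose_pos (by omega)) (by positivity)) (hfam S pay).1)
  set Y : J × (Fin M → Bool) → Cube n → Bool := fun i =>
    constantOnTerms L (2 * t) (fun j => (i.1.1 j).1) univ i.2 with hY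
  set Z : J × (Fin M → Bool) → Cube n → Bool := fun i =>
    literalOnTerms L (2 * t) (fun j => (i.1.1 j).1) i.1.2 i.2 with hZ
  set G : Finset J :=
    {p : J | L.m.choose (2 * t) ≤ 144 * #(criticalSets L (2 * t) (fun j => (p.1 j).1) p.2)}
    with hG
  set D : ℝ := Fintype.card J * Fintype.card (Fin M → Bool) with hD
  set δ : ℝ := D * (3 * (q * (2 * r + 1)) / (6 * t)) with hδ
  have ht0 : (0 : ℝ) < 6 * t := by exact_mod_cast (by omega)
  have hD0 : 0 < D := by
    have h1 : 0 < Fintype.card J := by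
      rw [hJ, Fintype.card_fun, Fintype.card_fun, card_term, Fintype.card_fin,
        Fintype.card_fin]
      exact Nat.mul_pos (pow_pos (Nat.choose_pos (by omega)) _) (pow_pos (by omega) _)
    rw [hD]
    have h2 : (0 : ℝ) < Fintype.card J := by exact_mod_cast h1
    have h3 : (0 : ℝ) < Fintype.card (Fin M → Bool) := by exact_mod_cast Fintype.card_pos
    positivity
  have hbad : ∀ A : NonadaptiveAlg n, A.MakesAtMost q →
      ∑ p : J, ∑ β : Fin M → Bool,
        expectedPayoff (constantOnTerms L (2 * t) (fun j => (p.1 j).1) univ β) (fun h pts _ =>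
          if ∃ j, p.2 j ∈ disagreement L (2 * t) (p.1 j).1 (h ++ pts) then 1 else 0) A []
      ≤ δ := by
    intro A hA
    have h1 := sum_bad_le (M := M) (t := t) (L := L) (r := r) (by omega) hm (by omega)
      (by rw [hm]; exact hr) A hA
    rw [Fintype.sum_prod_type]
    refine (le_of_eq ?_).trans (h1.trans ?_)
    · congr!
    · rw [hδ, hD, hJ, Nat.cast_mul]
      refine mul_le_mul_of_nonneg_left ?_ (by positivity)
      have h2 : (L.m : ℝ) = 6 * t := by exact_mod_cast hm
      rw [h2]
      refine div_le_div_of_nonneg_right ?_ ht0.le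
      have h3 := one_add_four_mul_termProb_pow_le ht hq
      have h4 := numTerms_mul_termProb_le t
      have h5 := termProb_nonneg t
      change (M : ℝ) * ((1 + 4 * termProb t) ^ q * (termProb t * (q * (2 * r + 1)))) ≤ _
      calc _ = (M * termProb t) * ((1 + 4 * termProb t) ^ q * (q * (2 * r + 1))) := by ring
        _ ≤ 1 * (3 * (q * (2 * r + 1))) := by gcongr
        _ = _ := one_mul _
  have hA : ∀ A ∈ T.support, ∑ i ∈ G ×ˢ univ, acceptProb (Y i) A
      ≤ ∑ i ∈ G ×ˢ univ, acceptProb (Z i) A + δ := by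
    intro A hAT
    rw [sum_product, sum_product]
    calc _ ≤ ∑ p ∈ G, (∑ β, acceptProb (Z (p, β)) A + ∑ β : Fin M → Bool,
        expectedPayoff (constantOnTerms L (2 * t) (fun j => (p.1 j).1) univ β) (fun h pts _ =>
          if ∃ j, p.2 j ∈ disagreement L (2 * t) (p.1 j).1 (h ++ pts) then 1 else 0) A []) := by
          refine sum_le_sum fun p _ => ?_
          refine (sum_acceptProb_le (k := 2 * t) (T := fun j => (p.1 j).1) p.2 A).trans
            (le_of_eq ?_)
          congr!
      _ ≤ _ := by
          rw [sum_add_distrib]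
          refine add_le_add_right (le_trans ?_ (hbad A (hTq A hAT))) _
          refine sum_le_sum_of_subset_of_nonneg (subset_univ _) fun p _ _ =>
            sum_nonneg fun β _ => expectedPayoff_nonneg (fun _ _ _ => ?_) _ _
          split_ifs <;> norm_num
  have hfin := card_le_of_acceptProb_le (G ×ˢ univ) Y Z (fun i => hne _ _) (fun i => hne _ _) T
    (fun i _ => (hT _ _ (h𝓓 _ (hfam _ _).1 (hfam _ _).2)).1 (truncatedTalagrand_mem_unate i.2))
    (fun i hi => (hT _ _ (h𝓓 _ (hfam _ _).1 (hfam _ _).2)).2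
      (le_relDistTo_unate (by omega) (by omega) i.2
        (mem_filter.1 (mem_product.1 hi).1).2))
    (by positivity) hA
  have hGc : (Fintype.card J : ℝ) / 36 ≤ #G := by
    convert card_le_card_filter_criticalSets (L := L) (t := t) (by omega) hm
  rw [card_product, card_univ, Nat.cast_mul, hδ] at hfin
  have h1 : D / 36 ≤ #G * Fintype.card (Fin M → Bool) := by
    rw [hD, mul_div_right_comm]
    gcongr
  -- A fraction `1/36` of the pairs (terms, variables) is good, and on those a tester's acceptance
  -- probabilities differ by at least `1/3`.
  have h2 : D * (1 / 108) ≤ D * (3 * (q * (2 * r + 1)) / (6 * t)) := by linarith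
  have h3 := le_of_mul_le_mul_left h2 hD0
  rw [div_le_div_iff₀ (by norm_num) ht0] at h3
  linarith

/-- The choice of the layout: a constant fraction of `log N` for `t`, and free coordinates to get
about `N` satisfying assignments. -/
theorem exists_layout {n ℓ t : ℕ} (hn : 6 * t + 2 + ℓ ≤ n) (ht : 6 * t ≤ ℓ) :
    ∃ L : Layout n, L.m = 6 * t ∧ 2 ^ ℓ ≤ (6 * t).choose (2 * t) * 2 ^ L.b ∧
      (6 * t).choose (2 * t) * 2 ^ L.b ≤ 2 ^ (ℓ + 1) := by
  set c := (6 * t).choose (2 * t) with hc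
  have hc0 : c ≠ 0 := (Nat.choose_pos (by omega)).ne'
  have h1 : Nat.log 2 c ≤ ℓ := by
    have h2 : c ≤ 2 ^ (6 * t) := Nat.choose_le_two_pow _ _
    have := Nat.log_mono_right (b := 2) h2
    rw [Nat.log_pow (by norm_num)] at this
    omega
  refine ⟨⟨6 * t, ℓ - Nat.log 2 c, by omega⟩, rfl, ?_, ?_⟩
  · calc 2 ^ ℓ = 2 ^ Nat.log 2 c * 2 ^ (ℓ - Nat.log 2 c) := by
          rw [← pow_add, Nat.add_sub_cancel' h1]
      _ ≤ _ := Nat.mul_le_mul_right _ (Nat.pow_log_le_self _ hc0)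
  · calc c * 2 ^ (ℓ - Nat.log 2 c) ≤ 2 ^ (Nat.log 2 c + 1) * 2 ^ (ℓ - Nat.log 2 c) :=
          Nat.mul_le_mul_right _ (Nat.lt_pow_succ_log_self (by norm_num) _).le
      _ = _ := by rw [← pow_add]; congr 1; omega

/-- Bounds for `log N` and `log log N` in terms of `⌊log₂ N⌋`. -/
theorem log_bounds {N ℓ : ℕ} (hℓ : 30 ≤ ℓ) (h1 : 2 ^ ℓ ≤ N) (h2 : N < 2 ^ (ℓ + 1)) :
    Real.log N ≤ 2 * ℓ ∧ 1 ≤ Real.log (Real.log N) ∧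
      (2 * (2 * (Nat.log 2 ℓ + 1) : ℕ) + 1 : ℝ) ≤ 21 * Real.log (Real.log N) := by
  have hl2 := Real.log_two_gt_d9
  have hl2' := Real.log_two_lt_d9
  have hℓ' : (30 : ℝ) ≤ ℓ := by exact_mod_cast hℓ
  have hN0 : (0 : ℝ) < N := by exact_mod_cast lt_of_lt_of_le (by positivity) h1
  have h3 : Real.log N ≤ (ℓ + 1) * Real.log 2 := by
    have h4 : (N : ℝ) ≤ 2 ^ (ℓ + 1) := by exact_mod_cast h2.le
    have := Real.log_le_log hN0 h4
    rw [Real.log_pow] at this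
    exact_mod_cast this
  have h4 : ℓ * Real.log 2 ≤ Real.log N := by
    have h5 : (2 : ℝ) ^ ℓ ≤ N := by exact_mod_cast h1
    have := Real.log_le_log (by positivity) h5
    rwa [Real.log_pow] at this
  have h5 : (ℓ : ℝ) / 2 ≤ Real.log N := by nlinarith
  have h6 : 1 ≤ Real.log (Real.log N) := by
    rw [Real.le_log_iff_exp_le (by linarith)]
    have := Real.exp_one_lt_three
    linarith
  refine ⟨by nlinarith, h6, ?_⟩
  have h7 : Real.log ℓ ≤ Real.log 2 + Real.log (Real.log N) := by
    rw [← Real.log_mul (by norm_num) (by linarith)]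
    exact Real.log_le_log (by linarith) (by linarith)
  have h8 : (Nat.log 2 ℓ : ℝ) * Real.log 2 ≤ Real.log ℓ := by
    have h9 : (2 : ℝ) ^ Nat.log 2 ℓ ≤ ℓ := by
      exact_mod_cast Nat.pow_log_le_self 2 (by omega : ℓ ≠ 0)
    have := Real.log_le_log (by positivity) h9
    rwa [Real.log_pow] at this
  have h9 : (Nat.log 2 ℓ : ℝ) * (1 / 2) ≤ Nat.log 2 ℓ * Real.log 2 := by gcongr; linarith
  push_cast
  linarith

end RelativeError

open Finset RelativeError in
theorem mainTheorem3 (α₀ : ℝ) (hα₀ : α₀ < 1) :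
    ∃ ε₀ : ℝ, 0 < ε₀ ∧ ∃ C : ℝ, 1 ≤ C ∧ ∃ c : ℝ, 0 < c ∧ ∃ k N₀ : ℕ,
      ∀ n N : ℕ, N₀ ≤ N → (N : ℝ) ≤ (2 : ℝ) ^ (α₀ * (n : ℝ)) →
        ∀ (T : RelativeError.RandomizedAlg n) (q : ℕ),
          RelativeError.IsTesterUnderPromise T ε₀ (RelativeError.unate n)
            (RelativeError.sizeWithinFactor n C N) →
          RelativeError.RandomizedAlg.MakesAtMost T q →
            c * Real.log N / Real.log (Real.log N) ^ k ≤ (q : ℝ) := by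
  have hδ : 0 < 1 - α₀ := by linarith
  -- With `t = ℓ / K`, the bound `K ≥ 6` gives `6 * t ≤ ℓ`, and the second one makes `6 * t + 2 ≤ 12
  -- * t` coordinates fit into the gap `(1 - α₀) * n`.
  obtain ⟨K, hK6, hKδ⟩ : ∃ K : ℕ, 6 ≤ K ∧ 12 ≤ (1 - α₀) * K := by
    obtain ⟨K, hK⟩ := exists_nat_ge (12 / (1 - α₀))
    refine ⟨max 6 K, le_max_left _ _, ?_⟩
    rw [div_le_iff₀ hδ] at hK
    have : (K : ℝ) ≤ (max 6 K : ℕ) := by exact_mod_cast le_max_right _ _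
    nlinarith
  have hK0 : (0 : ℝ) < K := by exact_mod_cast (by omega : 0 < K)
  -- `N₀` ensures `t ≥ 5`. The sizes lie between `2 ^ ℓ` and `6 * 2 ^ (ℓ + 1)`, hence between `N /
  -- 2` and `12 * N`.
  refine ⟨1 / 3456, by norm_num, 12, by norm_num, 1 / (10000 * K), by positivity, 1, 2 ^ (5 * K),
    fun n N hN hNn T q hT hTq => ?_⟩
  have hN0 : N ≠ 0 := (lt_of_lt_of_le (by positivity) hN).ne'
  set ℓ := Nat.log 2 N with hℓ
  have hℓ1 : 2 ^ ℓ ≤ N := Nat.pow_log_le_self _ hN0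
  have hℓ2 : N < 2 ^ (ℓ + 1) := Nat.lt_pow_succ_log_self (by norm_num) _
  have hℓK : 5 * K ≤ ℓ := by
    have := Nat.log_mono_right (b := 2) hN
    rwa [Nat.log_pow (by norm_num)] at this
  set t := ℓ / K with ht
  have htK : t * K ≤ ℓ := Nat.div_mul_le_self _ _
  have ht5 : 5 ≤ t := (Nat.le_div_iff_mul_le (by omega)).2 hℓK
  have hℓt : ℓ ≤ 2 * K * t := by
    have := Nat.lt_div_mul_add (a := ℓ) (b := K) (by omega)
    rw [← ht] at this
    nlinarith
  have ht6 : 6 * t ≤ ℓ := by nlinarith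
  have hnℓ : 6 * t + 2 + ℓ ≤ n := by
    have h1 : (2 : ℝ) ^ (ℓ : ℝ) ≤ 2 ^ (α₀ * n) := by
      rw [Real.rpow_natCast]
      exact le_trans (by exact_mod_cast hℓ1) hNn
    have h2 := (Real.rpow_le_rpow_left_iff (by norm_num : (1 : ℝ) < 2)).1 h1
    have h3 : (t : ℝ) * K ≤ ℓ := by exact_mod_cast htK
    have h4 : (5 : ℝ) ≤ t := by exact_mod_cast ht5
    have hn0 : (0 : ℝ) ≤ n := Nat.cast_nonneg _
    have h5 : (ℓ : ℝ) ≤ n := by nlinarith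
    have h6 : (12 : ℝ) * t ≤ (1 - α₀) * ℓ := by
      calc (12 : ℝ) * t ≤ (1 - α₀) * K * t := by gcongr
        _ = (1 - α₀) * (t * K) := by ring
        _ ≤ _ := by gcongr
    have h7 : (1 - α₀) * ℓ ≤ (1 - α₀) * n := by gcongr
    have h8 : (6 * t + 2 + ℓ : ℝ) ≤ n := by linarith
    exact_mod_cast h8
  obtain ⟨hlog, hloglog, hr⟩ := log_bounds (by omega) hℓ1 hℓ2
  have hy : 0 < Real.log (Real.log N) := by linarith
  have hℓt' : (ℓ : ℝ) ≤ 2 * K * t := by exact_mod_cast hℓt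
  rw [pow_one, div_le_iff₀ hy, one_div, inv_mul_le_iff₀ (by positivity)]
  -- If `q` exceeds `6 * t`, it is already of order `log N`.
  by_cases hq : q ≤ 6 * t
  · obtain ⟨L, hm, hW1, hW2⟩ := exists_layout hnℓ ht6
    have hmain := le_mul_queries L ht5 hm hq (r := 2 * (Nat.log 2 ℓ + 1)) ?_
      (𝓓 := sizeWithinFactor n 12 N) ?_ T hT hTq
    · have h1 : (6 * t : ℝ) ≤ 324 * q * (21 * Real.log (Real.log N)) := hmain.trans (by gcongr)
      calc Real.log N ≤ 2 * (2 * K * t) := by linarith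
        _ = K * (6 * t) * (2 / 3) := by ring
        _ ≤ K * (324 * q * (21 * Real.log (Real.log N))) * (2 / 3) := by gcongr
        _ = 4536 * (K * (q * Real.log (Real.log N))) := by ring
        _ ≤ 10000 * (K * (q * Real.log (Real.log N))) := by gcongr; norm_num
        _ = _ := by ring
    · have h1 : ℓ < 2 ^ (Nat.log 2 ℓ + 1) := Nat.lt_pow_succ_log_self (by norm_num) _
      rw [two_mul, pow_add]
      exact Nat.mul_le_mul (by omega) (by omega)
    · intro f hf1 hf2
      have h1 : N ≤ 2 * #(satSet f) := by rw [pow_succ] at hℓ2; omega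
      have h2 : #(satSet f) ≤ 12 * N := by rw [pow_succ] at hW2; omega
      have h1' : (N : ℝ) ≤ 2 * #(satSet f) := by exact_mod_cast h1
      have h2' : (#(satSet f) : ℝ) ≤ 12 * N := by exact_mod_cast h2
      have h3 : (0 : ℝ) ≤ N := Nat.cast_nonneg _
      exact ⟨by linarith, h2'⟩
  · have h1 : (6 * t : ℝ) ≤ q := by exact_mod_cast (not_le.1 hq).le
    calc Real.log N ≤ 2 * (2 * K * t) := by linarith
      _ = K * (6 * t) * (2 / 3) := by ring
      _ ≤ K * q * (2 / 3) := by gcongr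
      _ ≤ K * q * (10000 * Real.log (Real.log N)) := by gcongr; linarith
      _ = _ := by ring
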